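/- **Theorem 1.2 (Uncertainty quantification bounds).** Let $\mathcal X=\mathcal Q\times\mathcal P$ be a product of measurable spaces and $\mu^*=\nu^*\times\rho^*$ a product of probability measures. Write $\langle\cdot,\cdot\rangle$ for the scalar product of the real Hilbert space $L^2(\mu^*)$. *Baseline.* Let $(\Omega,\mathcal F_t,X_t,P^x)$, $x\in\mathcal X$, be a time-homogeneous $\mathcal X$-valued Markov process in continuous time, jointly measurable in $(t,\omega)$ (for instance càdlàg in a Polish space), with $P^x(X_0=x)=1$ and $x\mapsto P^x$ measurable. Put $P^{\mu^*}=\int P^x\,d\mu^*(x)$. Suppose that $\mu^*$ is invariant and that the semigroup $\mathcal P_tf(x)=E^x[f(X_t)]$ is strongly continuous on $L^2(\mu^*)$. Let $A$ be its generator, with domain $D(A)$, and let $T_A=\frac12(A-A^\dagger)$ on $D(A)\cap D(A^\dagger)$ be its antisymmetric part. Let $\Pi f(q,p)=\int f(q,p')\,d\rho^*(p')$. Suppose that $T_A\Pi$, with its natural domain $\{f:\Pi f\in D(T_A)\}$, is densely defined and closable, and let $$B=\big(I+(T_A\Pi)^*(T_A\Pi)\big)^{-1}(-T_A\Pi)^*,$$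 where inside the inverse $T_A\Pi$ is replaced by its closure; this formula determines a unique bounded operator on $L^2(\mu^*)$. For $\epsilon\in(0,1)$ put $\langle f,g\rangle_\epsilon=\langle f,g\rangle+\epsilon\langle f,(B+B^\dagger)g\rangle$. Suppose that for some $\epsilon\in(0,1)$ and some $\Lambda(\epsilon)>0$ the hypocoercive (modified Poincaré) estimate $$\langle -Ag,g\rangle_\epsilon\ \ge\ \Lambda(\epsilon)\,\operatorname{Var}_{\mu^*}[g]\qquad\text{for all } g\in D(A)$$ holds. *Alternative.* Let $(\widetilde X_t)_{t\ge0}$ be any $\mathcal X$-valued stochastic process, jointly measurable in $(t,\omega)$ but not necessarily Markov, on a probability space with measure $\widetilde P^{\widetilde\mu}$, where $\widetilde\mu$ is the law of $\widetilde X_0$. For $T>0$ let $P_T^{\mu^*}$ and $\widetilde P_T^{\widetilde\mu}$ be the path-space distributions on the time window $[0,T]$ of $X$ under $P^{\mu^*}$ and of $\widetilde X$, that is, their laws on $\mathcal X^{[0,T]}$ with the $\sigma$-algebra generated by the coordinates. Suppose that the relative entropy satisfies $R(\widetilde P_T^{\widetilde\mu}\|P_T^{\mu^*})<\infty$. Then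 for every bounded measurable $f:\mathcal X\to\mathbb R$, with $\widehat f=f-\mu^*[f]$, $$\left|\widetilde E^{\widetilde\mu}\left[\frac1T\int_0^T f(\widetilde X_t)\,dt\right]-\mu^*[f]\right|\ \le\ \sqrt{2v\,\eta_T}+b\,\eta_T,$$ where $$v=\frac{(1+\epsilon)\left(1-\frac{\epsilon^2}{4}\right)}{1-\epsilon}\,\frac{2\operatorname{Var}_{\mu^*}[f]}{\Lambda(\epsilon)},\qquad b=\frac{(1+\epsilon)^2}{1-\epsilon}\,\frac{\|\widehat f\|_{L^\infty(\mu^*)}}{\Lambda(\epsilon)},$$ $$\eta_T=\frac1T\left(\log\big((1-\epsilon)^{-1/2}\big)+R\big(\widetilde P_T^{\widetilde\mu}\,\|\,P_T^{\mu^*}\big)\right).$$ -/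

import Mathlib

open MeasureTheory ProbabilityTheory Filter Topology
open scoped NNReal ENNReal RealInnerProductSpace

noncomputable section

namespace Hypocoercive

/-! ### Markov kernels acting on `L²` of an invariant measure -/

section KernelOperator

variable {E : Type*} [MeasurableSpace E] {μ : Measure E}

theorem memLp_average {κ : Kernel E E} [IsMarkovKernel κ] (h : κ.Invariant μ) (f : Lp ℝ 2 μ) :
    MemLp (fun x => ∫ y, f y ∂(κ x)) 2 μ := by
  have hfm : StronglyMeasurable (f : E → ℝ) := Lp.stronglyMeasurable f
  refine ⟨(hfm.integral_kernel (κ := κ)).aestronglyMeasurable, ?_⟩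
  have key : ∀ x, ‖∫ y, f y ∂(κ x)‖ₑ ^ (2 : ℝ) ≤ ∫⁻ y, ‖f y‖ₑ ^ (2 : ℝ) ∂(κ x) := by
    intro x
    have h1 : ‖∫ y, f y ∂(κ x)‖ₑ ≤ eLpNorm f 1 (κ x) := by
      rw [eLpNorm_one_eq_lintegral_enorm]
      exact enorm_integral_le_lintegral_enorm _
    have h2 : eLpNorm f 1 (κ x) ≤ eLpNorm f 2 (κ x) :=
      eLpNorm_le_eLpNorm_of_exponent_le (by norm_num) hfm.aestronglyMeasurable
    have h3 := ENNReal.rpow_le_rpow (h1.trans h2) (by norm_num : (0 : ℝ) ≤ 2)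
    refine h3.trans (le_of_eq ?_)
    rw [eLpNorm_eq_lintegral_rpow_enorm_toReal (by norm_num) (by norm_num), ← ENNReal.rpow_mul]
    simp
  have hf := Lp.memLp f
  have hf2 := lintegral_rpow_enorm_lt_top_of_eLpNorm_lt_top (by norm_num) (by norm_num) hf.2
  rw [eLpNorm_lt_top_iff_lintegral_rpow_enorm_lt_top (by norm_num) (by norm_num)]
  refine lt_of_le_of_lt (lintegral_mono key) ?_
  rw [← Measure.lintegral_bind (f := fun y => ‖f y‖ₑ ^ (2 : ℝ)) κ.measurable.aemeasurable
    (hfm.measurable.enorm.pow_const _).aemeasurable, h.def]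
  simpa using hf2

theorem average_congr {κ : Kernel E E} (h : κ.Invariant μ) {f g : E → ℝ} (hfg : f =ᵐ[μ] g) :
    (fun x => ∫ y, f y ∂(κ x)) =ᵐ[μ] fun x => ∫ y, g y ∂(κ x) := by
  have h' : ∀ᵐ y ∂(μ.bind κ), f y = g y := by rw [h.def]; exact hfg
  filter_upwards [Measure.ae_ae_of_ae_comp h'] with x hx
  exact integral_congr_ae hx

theorem ae_integrable [IsFiniteMeasure μ] {κ : Kernel E E} [IsMarkovKernel κ] (h : κ.Invariant μ) (f : Lp ℝ 2 μ) :
    ∀ᵐ x ∂μ, Integrable f (κ x) := by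
  have hf : Integrable f (μ.bind κ) := by
    rw [h.def]; exact (Lp.memLp f).integrable (by norm_num)
  exact Measure.ae_integrable_of_integrable_comp hf

/-- The action `f ↦ (x ↦ ∫ f(y) κ(x, dy))` on `L²(μ)` of a Markov kernel `κ` leaving the
probability measure `μ` invariant. -/
def kernelOp [IsFiniteMeasure μ] (κ : Kernel E E) [IsMarkovKernel κ] (h : κ.Invariant μ) :
    Lp ℝ 2 μ →ₗ[ℝ] Lp ℝ 2 μ where
  toFun f := (memLp_average h f).toLp (fun x => ∫ y, f y ∂(κ x))
  map_add' f g := by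
    rw [← MemLp.toLp_add]
    apply MemLp.toLp_congr
    refine (average_congr h (Lp.coeFn_add f g)).trans ?_
    filter_upwards [ae_integrable h f, ae_integrable h g] with x hf hg
    exact integral_add hf hg
  map_smul' c f := by
    rw [RingHom.id_apply, ← MemLp.toLp_const_smul]
    apply MemLp.toLp_congr
    refine (average_congr h (Lp.coeFn_smul c f)).trans (Eventually.of_forall fun x => ?_)
    exact integral_smul c _

theorem kernelOp_apply [IsFiniteMeasure μ] (κ : Kernel E E) [IsMarkovKernel κ] (h : κ.Invariant μ) (f : Lp ℝ 2 μ) :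
    kernelOp κ h f =ᵐ[μ] fun x => ∫ y, f y ∂(κ x) :=
  (memLp_average h f).coeFn_toLp

end KernelOperator

/-! ### The velocity average -/

section VelocityAverage

variable {Q P : Type*} [MeasurableSpace Q] [MeasurableSpace P]

/-- The Markov kernel on `Q × P` which keeps `q` and resamples `p` from `ρ`. -/
def resample (Q : Type*) [MeasurableSpace Q] (ρ : Measure P) : Kernel (Q × P) (Q × P) :=
  Kernel.deterministic Prod.fst measurable_fst ×ₖ Kernel.const (Q × P) ρ

instance (ρ : Measure P) [IsProbabilityMeasure ρ] : IsMarkovKernel (resample Q ρ) := by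
  unfold resample; infer_instance

theorem resample_apply (ρ : Measure P) [IsProbabilityMeasure ρ] (z : Q × P) :
    resample Q ρ z = ρ.map (Prod.mk z.1) := by
  rw [resample, Kernel.prod_apply, Kernel.deterministic_apply, Kernel.const_apply,
    Measure.dirac_prod]

theorem resample_invariant (ν : Measure Q) (ρ : Measure P) [IsProbabilityMeasure ν]
    [IsProbabilityMeasure ρ] : (resample Q ρ).Invariant (ν.prod ρ) := by
  refine Measure.ext fun s hs => ?_
  rw [Measure.bind_apply hs (resample Q ρ).measurable.aemeasurable, Measure.prod_apply hs]
  simp_rw [resample_apply, Measure.map_apply measurable_prodMk_left hs]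
  rw [lintegral_prod _ (by
    exact ((measurable_measure_prodMk_left hs).comp measurable_fst).aemeasurable)]
  simp

/-- `(Π f)(q, p) = ∫ f(q, p') dρ(p')` as an operator on `L²(ν × ρ)`. -/
def velocityAverage (ν : Measure Q) (ρ : Measure P) [IsProbabilityMeasure ν]
    [IsProbabilityMeasure ρ] : Lp ℝ 2 (ν.prod ρ) →ₗ[ℝ] Lp ℝ 2 (ν.prod ρ) :=
  kernelOp (resample Q ρ) (resample_invariant ν ρ)

theorem velocityAverage_apply (ν : Measure Q) (ρ : Measure P) [IsProbabilityMeasure ν]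
    [IsProbabilityMeasure ρ] (f : Lp ℝ 2 (ν.prod ρ)) :
    velocityAverage ν ρ f =ᵐ[ν.prod ρ] fun z => ∫ p, f (z.1, p) ∂ρ := by
  refine (kernelOp_apply _ _ f).trans (Eventually.of_forall fun z => ?_)
  simp only [resample_apply]
  rw [integral_map measurable_prodMk_left.aemeasurable
    (Lp.stronglyMeasurable f).aestronglyMeasurable]

end VelocityAverage

/-! ### Unbounded operators -/

section Operators

variable {H : Type*} [NormedAddCommGroup H] [InnerProductSpace ℝ H]

/-- The pairs `(f, g)` with `g = lim_{t ↓ 0} (U_t f - f) / t`. -/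
def generatorGraph (U : ℝ≥0 → H →ₗ[ℝ] H) : Submodule ℝ (H × H) where
  carrier := {z | Tendsto (fun t : ℝ≥0 => (t : ℝ)⁻¹ • (U t z.1 - z.1)) (𝓝[>] 0) (𝓝 z.2)}
  add_mem' {a b} ha hb := by
    refine Tendsto.congr (fun t => ?_) (Tendsto.add ha hb)
    simp only [Prod.fst_add, map_add, ← smul_add]
    congr 1; abel
  zero_mem' := by simp
  smul_mem' c a ha := by
    refine Tendsto.congr (fun t => ?_) (Tendsto.const_smul ha c)
    simp only [Prod.smul_fst, map_smul, ← smul_sub]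
    rw [smul_comm]

/-- The infinitesimal generator of a one-parameter family of operators, on its maximal domain. -/
def generator (U : ℝ≥0 → H →ₗ[ℝ] H) : H →ₗ.[ℝ] H :=
  (generatorGraph U).toLinearPMap

theorem generator_graph (U : ℝ≥0 → H →ₗ[ℝ] H) : (generator U).graph = generatorGraph U := by
  refine Submodule.toLinearPMap_graph_eq _ fun z hz h0 => ?_
  refine tendsto_nhds_unique (f := fun _ : ℝ≥0 => (0 : H)) (l := 𝓝[>] (0 : ℝ≥0)) ?_
    tendsto_const_nhds
  refine Tendsto.congr (fun t => ?_) hz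
  simp [h0]

/-- The composition `T Π` on its natural domain `{f | Π f ∈ D(T)}`. -/
def compOp (T : H →ₗ.[ℝ] H) (R : H →ₗ[ℝ] H) : H →ₗ.[ℝ] H where
  domain := T.domain.comap R
  toFun := T.toFun ∘ₗ R.restrict (p := T.domain.comap R) (q := T.domain) fun _ h => h

/-- The graph of `C` in the Hilbert sum `H ⊕ H`, closed up. -/
def hilbertGraph (C : H →ₗ.[ℝ] H) : Submodule ℝ (WithLp 2 (H × H)) :=
  (C.graph.map (WithLp.linearEquiv 2 ℝ (H × H)).symm.toLinearMap).topologicalClosure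

theorem mem_hilbertGraph (C : H →ₗ.[ℝ] H) (hC : C.IsClosable) (z : WithLp 2 (H × H)) :
    z ∈ hilbertGraph C ↔ (z.fst, z.snd) ∈ C.closure.graph := by
  rw [← hC.graph_closure_eq_closure_graph]
  let e := (WithLp.prodContinuousLinearEquiv 2 ℝ H H).symm.toHomeomorph
  have h1 : (hilbertGraph C : Set (WithLp 2 (H × H))) = e '' (closure (C.graph : Set (H × H))) := by
    rw [e.image_closure]; rfl
  rw [← SetLike.mem_coe, h1]
  constructor
  · rintro ⟨y, hy, rfl⟩
    exact hy
  · intro hz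
    exact ⟨(z.fst, z.snd), hz, rfl⟩

variable [CompleteSpace H]

/-- The antisymmetric part `T = (A - A†) / 2`, on `D(A) ∩ D(A†)`. -/
def antisymmPart (A : H →ₗ.[ℝ] H) : H →ₗ.[ℝ] H := (2⁻¹ : ℝ) • (A - A.adjoint)

/-- `B` is the bounded operator `(I + C* C)⁻¹ (-C)*`: for every `f ∈ D(C*)`, `u = B f` solves
`u + C* C u = -C* f`. In the product `C* C` the operator `C` is replaced by its closure. -/
def IsModifier (C : H →ₗ.[ℝ] H) (B : H →L[ℝ] H) : Prop :=
  ∀ f : C.adjoint.domain, ∃ (hu : B f ∈ C.closure.domain)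
    (hv : C.closure ⟨B f, hu⟩ ∈ C.adjoint.domain),
    B f + C.adjoint ⟨C.closure ⟨B f, hu⟩, hv⟩ = -(C.adjoint f)

instance (C : H →ₗ.[ℝ] H) : (hilbertGraph C).HasOrthogonalProjection := by
  have : CompleteSpace (hilbertGraph C) :=
    (Submodule.isClosed_topologicalClosure _).completeSpace_coe
  infer_instance

theorem proj_spec (C : H →ₗ.[ℝ] H) (hd : Dense (C.domain : Set H)) (hC : C.IsClosable) (f : H) :
    ∃ (hx : ((hilbertGraph C).starProjection (WithLp.toLp 2 (0, f))).fst ∈ C.closure.domain)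
      (hy : ((hilbertGraph C).starProjection (WithLp.toLp 2 (0, f))).snd - f ∈ C.adjoint.domain),
      C.closure ⟨_, hx⟩ = ((hilbertGraph C).starProjection (WithLp.toLp 2 (0, f))).snd ∧
      C.adjoint ⟨_, hy⟩ = -((hilbertGraph C).starProjection (WithLp.toLp 2 (0, f))).fst := by
  have hmem := (mem_hilbertGraph C hC _).1
    ((hilbertGraph C).starProjection_apply_mem (WithLp.toLp 2 (0, f)))
  have hort : ∀ a : C.domain,
      ⟪-((hilbertGraph C).starProjection (WithLp.toLp 2 (0, f))).fst, (a : H)⟫ =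
      ⟪((hilbertGraph C).starProjection (WithLp.toLp 2 (0, f))).snd - f, C a⟫ := by
    intro a
    have ha : WithLp.toLp 2 ((a : H), C a) ∈ hilbertGraph C :=
      (mem_hilbertGraph C hC _).2 (LinearPMap.le_graph_of_le C.le_closure (C.mem_graph a))
    have h := (hilbertGraph C).starProjection_inner_eq_zero (WithLp.toLp 2 (0, f)) _ ha
    rw [WithLp.prod_inner_apply] at h
    simp [inner_sub_left] at h ⊢
    linarith
  have hy := LinearPMap.mem_adjoint_domain_of_exists (T := C) _ ⟨_, hort⟩
  obtain ⟨w, hw1, hw2⟩ := (LinearPMap.mem_graph_iff _).1 hmem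
  have hx : ((hilbertGraph C).starProjection (WithLp.toLp 2 (0, f))).fst ∈ C.closure.domain := by
    have := w.2
    rwa [hw1] at this
  refine ⟨hx, hy, ?_, LinearPMap.adjoint_apply_eq hd _ hort⟩
  refine Eq.trans ?_ hw2
  congr 1
  exact Subtype.ext hw1.symm

theorem adjoint_closure (C : H →ₗ.[ℝ] H) (hd : Dense (C.domain : Set H)) (hC : C.IsClosable)
    (w : C.adjoint.domain) (z : C.closure.domain) :
    ⟪C.adjoint w, (z : H)⟫ = ⟪(w : H), C.closure z⟫ := by
  have hz : ((z : H), C.closure z) ∈ C.graph.topologicalClosure := by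
    rw [hC.graph_closure_eq_closure_graph]; exact C.closure.mem_graph z
  have hcl : IsClosed {p : H × H | ⟪C.adjoint w, p.1⟫ = ⟪(w : H), p.2⟫} :=
    isClosed_eq (by fun_prop) (by fun_prop)
  have hsub : (C.graph : Set (H × H)) ⊆ {p : H × H | ⟪C.adjoint w, p.1⟫ = ⟪(w : H), p.2⟫} := by
    intro p hp
    obtain ⟨a, ha1, ha2⟩ := (LinearPMap.mem_graph_iff _).1 hp
    change ⟪C.adjoint w, p.1⟫ = ⟪(w : H), p.2⟫
    rw [← ha1, ← ha2]
    exact LinearPMap.adjoint_isFormalAdjoint hd w a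
  exact closure_minimal hsub hcl hz

theorem dense_adjoint_domain (C : H →ₗ.[ℝ] H) (hd : Dense (C.domain : Set H))
    (hC : C.IsClosable) : Dense (C.adjoint.domain : Set H) := by
  rw [Submodule.dense_iff_topologicalClosure_eq_top, Submodule.topologicalClosure_eq_top_iff,
    Submodule.eq_bot_iff]
  intro h hh
  obtain ⟨hx, hy, h1, h2⟩ := proj_spec C hd hC h
  set x := ((hilbertGraph C).starProjection (WithLp.toLp 2 (0, h))).fst
  set y := ((hilbertGraph C).starProjection (WithLp.toLp 2 (0, h))).snd
  have e1 : ⟪y - h, h⟫ = 0 := hh _ hy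
  have e2 := adjoint_closure C hd hC ⟨_, hy⟩ ⟨_, hx⟩
  rw [h1, h2] at e2
  simp only [inner_neg_left, inner_sub_left] at e1 e2
  have e3 : ‖x‖ ^ 2 + ‖y - h‖ ^ 2 = 0 := by
    rw [norm_sub_sq_real, ← real_inner_self_eq_norm_sq, ← real_inner_self_eq_norm_sq,
      ← real_inner_self_eq_norm_sq]
    rw [real_inner_comm] at e2
    have := real_inner_comm y h
    have := real_inner_comm x y
    have := real_inner_comm x x
    linarith
  have ex : x = 0 := by
    have : ‖x‖ ^ 2 = 0 := by nlinarith [sq_nonneg ‖x‖, sq_nonneg ‖y - h‖]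
    simpa using this
  have ey : y = h := by
    have : ‖y - h‖ ^ 2 = 0 := by nlinarith [sq_nonneg ‖x‖, sq_nonneg ‖y - h‖]
    exact sub_eq_zero.1 (by simpa using this)
  rw [← ey, ← h1]
  have : (⟨x, hx⟩ : C.closure.domain) = 0 := Subtype.ext ex
  rw [this, LinearPMap.map_zero]

/-- For a densely defined closable `C`, the formula `(I + C* C)⁻¹ (-C)*` defines exactly one
bounded operator. -/
theorem existsUnique_isModifier (C : H →ₗ.[ℝ] H) (hd : Dense (C.domain : Set H))
    (hC : C.IsClosable) : ∃! B : H →L[ℝ] H, IsModifier C B := by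
  let B₀ : H →L[ℝ] H := -((WithLp.fstL 2 ℝ H H).comp
    ((hilbertGraph C).starProjection.comp
      ((WithLp.prodContinuousLinearEquiv 2 ℝ H H).symm.toContinuousLinearMap.comp
        (ContinuousLinearMap.inr ℝ H H))))
  have hB₀ : ∀ f, B₀ f = -((hilbertGraph C).starProjection (WithLp.toLp 2 (0, f))).fst :=
    fun f => rfl
  have hB₀' : IsModifier C B₀ := by
    intro f
    obtain ⟨hx, hy, h1, h2⟩ := proj_spec C hd hC f
    have hu : B₀ f ∈ C.closure.domain := by rw [hB₀]; exact C.closure.domain.neg_mem hx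
    have hv1 : C.closure ⟨B₀ f, hu⟩ =
        -((hilbertGraph C).starProjection (WithLp.toLp 2 (0, (f : H)))).snd := by
      rw [← h1, ← LinearPMap.map_neg]
      congr 1
    have hv2 : C.closure ⟨B₀ f, hu⟩ = ((-⟨_, hy⟩ - f : C.adjoint.domain) : H) := by
      rw [hv1]
      simp
    refine ⟨hu, hv2 ▸ Subtype.coe_prop _, ?_⟩
    have : C.adjoint ⟨C.closure ⟨B₀ f, hu⟩, hv2 ▸ Subtype.coe_prop _⟩ =
        C.adjoint (-⟨_, hy⟩ - f) := by
      congr 1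
      exact Subtype.ext hv2
    rw [this, LinearPMap.map_sub, LinearPMap.map_neg, h2, hB₀]
    abel
  refine ⟨B₀, hB₀', ?_⟩
  · intro B hB
    have key : ∀ B B' : H →L[ℝ] H, IsModifier C B → IsModifier C B' →
        ∀ f : C.adjoint.domain, B f = B' f := by
      intro B B' hB hB' f
      obtain ⟨hu, hv, h⟩ := hB f
      obtain ⟨hu', hv', h'⟩ := hB' f
      have e := adjoint_closure C hd hC (⟨_, hv⟩ - ⟨_, hv'⟩) (⟨_, hu⟩ - ⟨_, hu'⟩)
      rw [LinearPMap.map_sub, LinearPMap.map_sub] at e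
      have e' : C.adjoint ⟨C.closure ⟨B f, hu⟩, hv⟩ - C.adjoint ⟨C.closure ⟨B' f, hu'⟩, hv'⟩ =
          -(B f - B' f) := by
        have := h.trans h'.symm
        rw [← sub_eq_zero] at this ⊢
        rw [← this]; abel
      rw [e'] at e
      simp only [Submodule.coe_sub] at e
      rw [inner_neg_left, real_inner_self_eq_norm_sq, real_inner_self_eq_norm_sq] at e
      have : ‖B f - B' f‖ ^ 2 = 0 := by
        nlinarith [sq_nonneg ‖B f - B' f‖,
          sq_nonneg ‖C.closure ⟨B f, hu⟩ - C.closure ⟨B' f, hu'⟩‖]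
      exact sub_eq_zero.1 (by simpa using this)
    have heq := Continuous.ext_on (dense_adjoint_domain C hd hC) B.continuous B₀.continuous
      fun f hf => key B B₀ hB hB₀' ⟨f, hf⟩
    exact ContinuousLinearMap.ext fun x => congrFun heq x

/-- The bounded operator `(I + C* C)⁻¹ (-C)*`. -/
def modifier (C : H →ₗ.[ℝ] H) (hd : Dense (C.domain : Set H)) (hC : C.IsClosable) : H →L[ℝ] H :=
  (existsUnique_isModifier C hd hC).choose

/-- The modified scalar product `⟨f, g⟩_ε = ⟨f, g⟩ + ε ⟨f, (B + B*) g⟩`. -/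
def modInner (ε : ℝ) (B : H →L[ℝ] H) (f g : H) : ℝ :=
  ⟪f, g⟫ + ε * ⟪f, (B + ContinuousLinearMap.adjoint B) g⟫

end Operators

/-! ### Markov processes -/

/-- A time-homogeneous Markov process `(Ω, 𝓕_t, X_t, P^x)` with state space `E`. -/
structure MarkovProcess (E Ω : Type*) [MeasurableSpace E] [mΩ : MeasurableSpace Ω] where
  /-- The process `X_t(ω)`. -/
  X : ℝ≥0 → Ω → E
  /-- The filtration `𝓕_t`. -/
  filtration : Filtration ℝ≥0 mΩ
  /-- The laws `P^x`, depending measurably on `x`. -/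
  law : Kernel E Ω
  isMarkovKernel_law : IsMarkovKernel law
  measurable_uncurry : Measurable (Function.uncurry X)
  adapted : ∀ t, Measurable[filtration t] (X t)
  initial : ∀ x, (law x).map (X 0) = Measure.dirac x
  markov : ∀ (x : E) (s t : ℝ≥0) (S : Set E), MeasurableSet S →
    (law x)⟦X (s + t) ⁻¹' S | filtration s⟧ =ᵐ[law x]
      fun ω => (law (X s ω)).real (X t ⁻¹' S)

namespace MarkovProcess

variable {E Ω : Type*} [MeasurableSpace E] [MeasurableSpace Ω] (M : MarkovProcess E Ω)

instance : IsMarkovKernel M.law := M.isMarkovKernel_law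

theorem measurable_X (t : ℝ≥0) : Measurable (M.X t) :=
  M.measurable_uncurry.comp measurable_prodMk_left

/-- The measure `P^μ = ∫ P^x dμ(x)`. -/
def lawFrom (μ : Measure E) : Measure Ω := μ.bind M.law

/-- The transition kernel `x ↦ P^x(X_t ∈ ·)`. -/
def transition (t : ℝ≥0) : Kernel E E := M.law.map (M.X t)

instance (t : ℝ≥0) : IsMarkovKernel (M.transition t) :=
  Kernel.IsMarkovKernel.map _ (M.measurable_X t)

/-- `μ` is an invariant measure. -/
def Invariant (μ : Measure E) : Prop := ∀ t, (M.transition t).Invariant μ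

variable {M} {μ : Measure E} [IsFiniteMeasure μ]

/-- The semigroup `f ↦ (x ↦ E^x[f(X_t)])` on `L²(μ)`. -/
def semigroup (h : M.Invariant μ) (t : ℝ≥0) : Lp ℝ 2 μ →ₗ[ℝ] Lp ℝ 2 μ :=
  kernelOp (M.transition t) (h t)

theorem semigroup_apply (h : M.Invariant μ) (t : ℝ≥0) (f : Lp ℝ 2 μ) :
    semigroup h t f =ᵐ[μ] fun x => ∫ ω, f (M.X t ω) ∂(M.law x) := by
  refine (kernelOp_apply _ _ f).trans (Eventually.of_forall fun x => ?_)
  simp only [transition, Kernel.map_apply _ (M.measurable_X t)]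
  rw [integral_map (M.measurable_X t).aemeasurable (Lp.stronglyMeasurable f).aestronglyMeasurable]

/-- The semigroup is strongly continuous on `L²(μ)`. -/
def StronglyContinuous (h : M.Invariant μ) : Prop :=
  ∀ f : Lp ℝ 2 μ, Tendsto (fun t => semigroup h t f) (𝓝 0) (𝓝 f)

/-- The generator of the semigroup on `L²(μ)`. -/
def gen (h : M.Invariant μ) : Lp ℝ 2 μ →ₗ.[ℝ] Lp ℝ 2 μ := generator (semigroup h)

end MarkovProcess

/-- The operator `T Π` of a process on `Q × P` with invariant measure `ν × ρ`, where `T` is the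
antisymmetric part of the generator and `Π` is the velocity average. -/
def transportOp {Q P Ω : Type*} [MeasurableSpace Q] [MeasurableSpace P] [MeasurableSpace Ω]
    {ν : Measure Q} [IsProbabilityMeasure ν] {ρ : Measure P} [IsProbabilityMeasure ρ]
    {M : MarkovProcess (Q × P) Ω} (h : M.Invariant (ν.prod ρ)) :
    Lp ℝ 2 (ν.prod ρ) →ₗ.[ℝ] Lp ℝ 2 (ν.prod ρ) :=
  compOp (antisymmPart (MarkovProcess.gen h)) (velocityAverage ν ρ)

/-! ### Path-space quantities -/

/-- The path-space distribution of a process on the time window `[0, T]`, as a law on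
`[0, T] → E` with the σ-algebra generated by the coordinates. -/
def pathLaw {E Ω : Type*} [MeasurableSpace E] [MeasurableSpace Ω] (X : ℝ≥0 → Ω → E)
    (κ : Measure Ω) (T : ℝ≥0) : Measure (Set.Icc (0 : ℝ≥0) T → E) :=
  κ.map fun ω t => X t ω

/-- The ergodic average `(1/T) ∫₀ᵀ f(X_t(ω)) dt`. -/
def timeAverage {E Ω : Type*} (X : ℝ≥0 → Ω → E) (f : E → ℝ) (T : ℝ≥0) (ω : Ω) : ℝ :=
  (1 / (T : ℝ)) * ∫ t in (0 : ℝ)..T, f (X t.toNNReal ω)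

/-- The variance factor `v`. -/
def vConst {E : Type*} [MeasurableSpace E] (μ : Measure E) (f : E → ℝ) (ε Λ : ℝ) : ℝ :=
  (1 + ε) * (1 - ε ^ 2 / 4) / (1 - ε) * (2 * Var[f; μ] / Λ)

/-- The scale factor `b`, with the `L^∞(μ)` norm of `f - μ[f]`. -/
def bConst {E : Type*} [MeasurableSpace E] (μ : Measure E) (f : E → ℝ) (ε Λ : ℝ) : ℝ :=
  (1 + ε) ^ 2 / (1 - ε) * ((eLpNorm (fun x => f x - ∫ y, f y ∂μ) ∞ μ).toReal / Λ)

/-- `η_T = (1/T) (log((1 - ε)^{-1/2}) + R)`. -/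
def eta (ε R : ℝ) (T : ℝ≥0) : ℝ :=
  (1 / (T : ℝ)) * (Real.log ((1 - ε) ^ (-(1 / 2) : ℝ)) + R)

end Hypocoercive

end

noncomputable section

set_option linter.unusedSectionVars false

namespace Hypocoercive

/-! ### Strongly continuous contraction semigroups -/

section Semigroup

variable {H : Type*} [NormedAddCommGroup H] [InnerProductSpace ℝ H]

/-! Put `V = l (f - μ[f])` with `l > 0`. The entropy inequality bounds the alternative's expectation
of `∫₀ᵀ V(X_t) dt` by the relative entropy plus the logarithm of the baseline exponential moment. By
Feynman–Kac that moment is `⟪1, W_T 1⟫`, where `W` is the semigroup generated by `A + V`. In the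
modified norm the constant function has length one and is orthogonal to the mean-zero functions,
because `B` and its adjoint kill constants. The hypocoercive estimate therefore absorbs the action
of `V` on the mean-zero part, and a completed square yields the form bound `⟪(A + V) g, g⟫_ε ≤ κ ⟪g,
g⟫_ε` (`perturbed_form_le`), with `κ` of order `l² Var[f] / Λ`. Hence `W_T 1` has modified norm at
most `exp (κ T)`. Since `‖B‖ ≤ 1/2`, returning to the `L²` norm costs the factor `(1 - ε)^(-1/2)`.
Optimising over `l` (`le_sqrt_add_of_forall`) gives the square-root-plus-linear bound, and `-f`
gives the other sign.

The path laws live on the coordinate σ-algebra and paths have no regularity, so a time integral need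
not be a measurable functional of the path. Feynman–Kac is replaced by stratified sampling. Cut `[0,
T]` into `n` windows of length `h`, choose one time `τ i` for each window, and use the finitely
based weight `∏ (1 + h V(X_{τ i}))`. Averaging over a uniform time in a window turns the factor for
that window into the Dyson operator `U_h + ∫₀ʰ U_{h-r} V U_r dr` (`dyson_eq_integral`). The entropy
inequality is used in a form linear in the exponential moment, so some deterministic choice of times
does at least as well as the average (`exists_sample_times`).

One Dyson step multiplies the squared modified norm by at most `1 + 2 κ h + C h²` (`dyson_growth`).
This rests on `energy_mild`, an energy inequality for mild solutions. All discretisation errors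
vanish as `n → ∞`. -/

/-- A strongly continuous semigroup of contractions. -/
structure IsContractionSemigroup (U : ℝ≥0 → H →ₗ[ℝ] H) : Prop where
  zero : ∀ x, U 0 x = x
  add : ∀ s t x, U (s + t) x = U s (U t x)
  contraction : ∀ t x, ‖U t x‖ ≤ ‖x‖
  tendsto : ∀ x, Tendsto (fun t => U t x) (𝓝 0) (𝓝 x)

namespace IsContractionSemigroup

variable {U : ℝ≥0 → H →ₗ[ℝ] H} (hU : IsContractionSemigroup U)

/-- The semigroup as a family of bounded operators indexed by the real line, constant for negative
times. -/
def flow (hU : IsContractionSemigroup U) (s : ℝ) : H →L[ℝ] H :=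
  (U s.toNNReal).mkContinuous 1 fun x => by simpa using hU.contraction _ x

theorem flow_apply (s : ℝ) (x : H) : hU.flow s x = U s.toNNReal x := rfl

theorem norm_flow_le (s : ℝ) (x : H) : ‖hU.flow s x‖ ≤ ‖x‖ := hU.contraction _ x

theorem flow_zero (x : H) : hU.flow 0 x = x := by
  rw [flow_apply, Real.toNNReal_zero, hU.zero]

theorem flow_add {s t : ℝ} (hs : 0 ≤ s) (ht : 0 ≤ t) (x : H) :
    hU.flow (s + t) x = hU.flow s (hU.flow t x) := by
  simp only [flow_apply, Real.toNNReal_add hs ht, hU.add]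

theorem norm_flow_sub_le {s t : ℝ} (hs : 0 ≤ s) (hst : s ≤ t) (x : H) :
    ‖hU.flow t x - hU.flow s x‖ ≤ ‖hU.flow (t - s) x - x‖ := by
  have h : hU.flow t x = hU.flow s (hU.flow (t - s) x) := by
    rw [← hU.flow_add hs (sub_nonneg.2 hst), add_sub_cancel]
  rw [h, ← map_sub]
  exact hU.norm_flow_le _ _

/-- The extended flow is constant at negative times, so only the positive parts of `s` and `t`
matter. -/
theorem norm_flow_sub_le_abs (s t : ℝ) (x : H) :
    ‖hU.flow t x - hU.flow s x‖ ≤ ‖hU.flow |max t 0 - max s 0| x - x‖ := by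
  have h : ∀ r : ℝ, hU.flow r x = hU.flow (max r 0) x := fun r => by
    simp [flow_apply, Real.toNNReal]
  rw [h t, h s]
  rcases le_total (max s 0) (max t 0) with hle | hle
  · rw [abs_of_nonneg (sub_nonneg.2 hle)]
    exact hU.norm_flow_sub_le (le_max_right _ _) hle x
  · rw [abs_of_nonpos (sub_nonpos.2 hle), neg_sub, norm_sub_rev]
    exact hU.norm_flow_sub_le (le_max_right _ _) hle x

theorem tendsto_flow_zero (x : H) : Tendsto (fun s => hU.flow s x) (𝓝 0) (𝓝 x) := by
  have h : Tendsto Real.toNNReal (𝓝 0) (𝓝 0) := by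
    simpa using continuous_real_toNNReal.tendsto 0
  exact (hU.tendsto x).comp h

theorem continuous_flow_apply (x : H) : Continuous fun s => hU.flow s x := by
  rw [continuous_iff_continuousAt]
  intro s
  rw [ContinuousAt, tendsto_iff_norm_sub_tendsto_zero]
  refine squeeze_zero (fun _ => norm_nonneg _) (fun t => hU.norm_flow_sub_le_abs s t x) ?_
  have h1 : Tendsto (fun t : ℝ => |max t 0 - max s 0|) (𝓝 s) (𝓝 0) := by
    have : Continuous fun t : ℝ => |max t 0 - max s 0| := by fun_prop
    simpa using this.tendsto s
  have h2 := ((hU.tendsto_flow_zero x).comp h1).sub_const x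
  simpa using h2.norm

theorem continuous_uncurry_flow : Continuous fun p : ℝ × H => hU.flow p.1 p.2 := by
  rw [continuous_iff_continuousAt]
  rintro ⟨s, x⟩
  rw [ContinuousAt, tendsto_iff_norm_sub_tendsto_zero]
  have hb : ∀ p : ℝ × H, ‖hU.flow p.1 p.2 - hU.flow s x‖ ≤
      ‖p.2 - x‖ + ‖hU.flow p.1 x - hU.flow s x‖ := fun p => by
    have : hU.flow p.1 p.2 - hU.flow s x =
        hU.flow p.1 (p.2 - x) + (hU.flow p.1 x - hU.flow s x) := by
      rw [map_sub]; abel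
    rw [this]
    exact (norm_add_le _ _).trans (by gcongr; exact hU.norm_flow_le _ _)
  refine squeeze_zero (fun _ => norm_nonneg _) hb ?_
  have hc : Continuous fun p : ℝ × H => ‖p.2 - x‖ + ‖hU.flow p.1 x - hU.flow s x‖ := by
    have := (hU.continuous_flow_apply x).comp (continuous_fst (X := ℝ) (Y := H))
    simp only [Function.comp_def] at this
    fun_prop
  simpa using hc.tendsto (s, x)

theorem continuous_flow_comp {α : Type*} [TopologicalSpace α] {a : α → ℝ} {b : α → H}
    (ha : Continuous a) (hb : Continuous b) : Continuous fun z => hU.flow (a z) (b z) :=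
  hU.continuous_uncurry_flow.comp (ha.prodMk hb)

variable [CompleteSpace H]

/-- The time average `δ⁻¹ ∫₀^δ U_r x dr`. -/
def smooth (δ : ℝ) : H →L[ℝ] H :=
  LinearMap.mkContinuous
    { toFun := fun x => δ⁻¹ • ∫ r in (0 : ℝ)..δ, hU.flow r x
      map_add' := fun x y => by
        simp only [map_add]
        rw [intervalIntegral.integral_add ((hU.continuous_flow_apply x).intervalIntegrable _ _)
          ((hU.continuous_flow_apply y).intervalIntegrable _ _), smul_add]
      map_smul' := fun c x => by
        simp only [map_smul, RingHom.id_apply]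
        rw [intervalIntegral.integral_smul, smul_comm] } 1 fun x => by
    have h := intervalIntegral.norm_integral_le_of_norm_le_const (a := 0) (b := δ)
      (f := fun r => hU.flow r x) (C := ‖x‖) fun r _ => hU.norm_flow_le r x
    rw [LinearMap.coe_mk, AddHom.coe_mk, norm_smul, one_mul, norm_inv, Real.norm_eq_abs]
    rw [sub_zero] at h
    rcases eq_or_ne δ 0 with rfl | hδ
    · simp
    · calc |δ|⁻¹ * ‖∫ r in (0 : ℝ)..δ, hU.flow r x‖ ≤ |δ|⁻¹ * (‖x‖ * |δ|) := by gcongr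
        _ = ‖x‖ := by have := abs_ne_zero.2 hδ; field_simp

theorem smooth_apply (δ : ℝ) (x : H) :
    hU.smooth δ x = δ⁻¹ • ∫ r in (0 : ℝ)..δ, hU.flow r x := rfl

theorem norm_smooth_le (δ : ℝ) (x : H) : ‖hU.smooth δ x‖ ≤ ‖x‖ := by
  have h : ‖hU.smooth δ‖ ≤ 1 := LinearMap.mkContinuous_norm_le _ zero_le_one _
  simpa using (hU.smooth δ).le_of_opNorm_le h x

theorem hasDerivAt_integral_flow (a s : ℝ) (x : H) :
    HasDerivAt (fun t => ∫ r in a..t, hU.flow r x) (hU.flow s x) s :=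
  intervalIntegral.integral_hasDerivAt_right ((hU.continuous_flow_apply x).intervalIntegrable _ _)
    (hU.continuous_flow_apply x).stronglyMeasurable.stronglyMeasurableAtFilter
    (hU.continuous_flow_apply x).continuousAt

theorem tendsto_smooth (x : H) : Tendsto (fun δ => hU.smooth δ x) (𝓝[>] 0) (𝓝 x) := by
  have h := (hU.hasDerivAt_integral_flow 0 0 x).hasDerivWithinAt (s := Set.Ioi 0)
  rw [hasDerivWithinAt_iff_tendsto_slope' (by simp), flow_zero] at h
  refine h.congr fun δ => ?_
  simp [slope_def_module, smooth_apply]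

/-- Flowing for time `k` shifts the averaging window, so the orbit is `δ⁻¹ (∫₀^{k+δ} - ∫₀^k)` of a
continuous function. Time averages thus lie in the domain of the generator. Only a one-sided
derivative is available at time `0`. -/
theorem hasDerivWithinAt_flow_smooth {δ : ℝ} (hδ : 0 < δ) (x : H) :
    HasDerivWithinAt (fun k => hU.flow k (hU.smooth δ x)) (δ⁻¹ • (hU.flow δ x - x))
      (Set.Ici 0) 0 := by
  have h1 : HasDerivAt (fun k : ℝ => δ⁻¹ • ((∫ r in (0 : ℝ)..(k + δ), hU.flow r x) -
      ∫ r in (0 : ℝ)..k, hU.flow r x)) (δ⁻¹ • (hU.flow δ x - x)) 0 := by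
    have ha := (hU.hasDerivAt_integral_flow 0 (0 + δ) x).comp_add_const 0 δ
    have hb := hU.hasDerivAt_integral_flow 0 0 x
    have := (ha.sub hb).const_smul δ⁻¹
    rw [zero_add, flow_zero] at this
    exact this
  refine h1.hasDerivWithinAt.congr (fun k hk => ?_) ?_
  · rw [smooth_apply, map_smul, ← ContinuousLinearMap.intervalIntegral_comp_comm _
      ((hU.continuous_flow_apply x).intervalIntegrable _ _)]
    congr 1
    have h2 : ∫ r in (0 : ℝ)..δ, hU.flow k (hU.flow r x) =
        ∫ r in (0 : ℝ)..δ, hU.flow (r + k) x := by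
      refine intervalIntegral.integral_congr fun r hr => ?_
      rw [Set.uIcc_of_le hδ.le] at hr
      rw [add_comm, hU.flow_add hk hr.1]
    rw [h2, intervalIntegral.integral_comp_add_right (fun r => hU.flow r x), zero_add,
      intervalIntegral.integral_interval_sub_left
      ((hU.continuous_flow_apply x).intervalIntegrable _ _)
      ((hU.continuous_flow_apply x).intervalIntegrable _ _), add_comm]
  · simp [smooth_apply, flow_zero]

theorem smooth_mem_generatorGraph {δ : ℝ} (hδ : 0 < δ) (x : H) :
    (hU.smooth δ x, δ⁻¹ • (hU.flow δ x - x)) ∈ generatorGraph U := by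
  have h := (hU.hasDerivWithinAt_flow_smooth hδ x).mono Set.Ioi_subset_Ici_self
  rw [hasDerivWithinAt_iff_tendsto_slope' (by simp)] at h
  have hc : Tendsto (fun t : ℝ≥0 => (t : ℝ)) (𝓝[>] 0) (𝓝[>] 0) := by
    refine tendsto_nhdsWithin_iff.2 ⟨?_, ?_⟩
    · exact (NNReal.continuous_coe.tendsto' 0 0 rfl).mono_left nhdsWithin_le_nhds
    · filter_upwards [self_mem_nhdsWithin] with t ht
      exact_mod_cast ht
  refine (h.comp hc).congr fun t => ?_
  simp only [Function.comp, slope_def_module, sub_zero, flow_zero]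
  simp [flow_apply]

theorem dense_generator_domain (hU : IsContractionSemigroup U) :
    Dense ((generator U).domain : Set H) := by
  intro x
  refine mem_closure_of_tendsto (hU.tendsto_smooth x) ?_
  filter_upwards [self_mem_nhdsWithin] with δ hδ
  have h := hU.smooth_mem_generatorGraph hδ x
  rw [← generator_graph] at h
  obtain ⟨y, hy, -⟩ := (LinearPMap.mem_graph_iff _).1 h
  have := y.2
  rw [hy] at this
  exact this

/-! ### Mild solutions -/

/-- The mild solution `U_s g + ∫₀ˢ U_{s-r} F_r dr` of `w' = A w + F`, `w_0 = g`. -/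
def mild (g : H) (F : ℝ → H) (s : ℝ) : H :=
  hU.flow s g + ∫ r in (0 : ℝ)..s, hU.flow (s - r) (F r)

theorem continuous_mild (g : H) {F : ℝ → H} (hF : Continuous F) : Continuous (hU.mild g F) := by
  refine (hU.continuous_flow_apply g).add ?_
  refine intervalIntegral.continuous_parametric_intervalIntegral_of_continuous
    (f := fun s r => hU.flow (s - r) (F r)) ?_ continuous_id
  exact hU.continuous_flow_comp (continuous_fst.sub continuous_snd) (hF.comp continuous_snd)

theorem mild_zero (g : H) (F : ℝ → H) : hU.mild g F 0 = g := by
  simp [mild, flow_zero]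

theorem continuous_kernel (s : ℝ) {F : ℝ → H} (hF : Continuous F) :
    Continuous fun r => hU.flow (s - r) (F r) :=
  hU.continuous_flow_comp (continuous_const.sub continuous_id) hF

/-- Restarting at time `s` reduces differentiation at `s` to differentiation of an orbit at time `0`
and of a Duhamel integral over a shrinking interval. -/
theorem mild_eq_of_le (g : H) {F : ℝ → H} (hF : Continuous F) {s t : ℝ} (hs : 0 ≤ s)
    (hst : s ≤ t) :
    hU.mild g F t = hU.flow (t - s) (hU.mild g F s) + ∫ r in s..t, hU.flow (t - r) (F r) := by
  have h1 : hU.flow t g = hU.flow (t - s) (hU.flow s g) := by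
    rw [← hU.flow_add (sub_nonneg.2 hst) hs, sub_add_cancel]
  have h2 : ∫ r in (0 : ℝ)..s, hU.flow (t - r) (F r) =
      hU.flow (t - s) (∫ r in (0 : ℝ)..s, hU.flow (s - r) (F r)) := by
    rw [← ContinuousLinearMap.intervalIntegral_comp_comm _
      ((hU.continuous_kernel s hF).intervalIntegrable _ _)]
    refine intervalIntegral.integral_congr fun r hr => ?_
    rw [Set.uIcc_of_le hs] at hr
    rw [← hU.flow_add (sub_nonneg.2 hst) (sub_nonneg.2 hr.2)]
    congr 2
    ring
  rw [mild, mild, map_add, ← h1, ← h2, add_assoc, intervalIntegral.integral_add_adjacent_intervals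
    ((hU.continuous_kernel t hF).intervalIntegrable _ _)
    ((hU.continuous_kernel t hF).intervalIntegrable _ _)]

theorem norm_mild_sub_flow_le (g : H) {F : ℝ → H} {c s : ℝ} (hs : 0 ≤ s)
    (hF : ∀ r, ‖F r‖ ≤ c) : ‖hU.mild g F s - hU.flow s g‖ ≤ c * s := by
  rw [mild, add_sub_cancel_left]
  have h := intervalIntegral.norm_integral_le_of_norm_le_const (a := 0) (b := s)
    (f := fun r => hU.flow (s - r) (F r)) (C := c) fun r _ => (hU.norm_flow_le _ _).trans (hF r)
  rwa [sub_zero, abs_of_nonneg hs] at h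

/-- The integrand is jointly continuous and equals `F s` at the corner `(s, s)`, so no
differentiability of the flow is needed. -/
theorem hasDerivWithinAt_duhamel {F : ℝ → H} (hF : Continuous F) (s : ℝ) :
    HasDerivWithinAt (fun t => ∫ r in s..t, hU.flow (t - r) (F r)) (F s) (Set.Ici s) s := by
  rw [hasDerivWithinAt_iff_isLittleO, Asymptotics.isLittleO_iff]
  intro c hc
  have hj : Continuous fun p : ℝ × ℝ => hU.flow (p.1 - p.2) (F p.2) :=
    hU.continuous_flow_comp (continuous_fst.sub continuous_snd) (hF.comp continuous_snd)
  have h0 := Metric.continuousAt_iff.1 (hj.continuousAt (x := (s, s))) c hc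
  obtain ⟨η, hη, hb⟩ := h0
  have hnear : ∀ᶠ t in 𝓝[≥] s, dist t s < η :=
    nhdsWithin_le_nhds (Metric.ball_mem_nhds s hη)
  filter_upwards [hnear, self_mem_nhdsWithin] with t ht hst
  have hst : s ≤ t := hst
  have e : (∫ r in s..t, hU.flow (t - r) (F r)) - (∫ r in s..s, hU.flow (s - r) (F r)) -
      (t - s) • F s = ∫ r in s..t, (hU.flow (t - r) (F r) - F s) := by
    rw [intervalIntegral.integral_sub ((hU.continuous_kernel t hF).intervalIntegrable _ _)
      (by simp)]
    simp
  rw [e, Real.norm_eq_abs]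
  refine intervalIntegral.norm_integral_le_of_norm_le_const fun r hr => ?_
  rw [Set.uIoc_of_le hst] at hr
  have := @hb (t, r) (by
    rw [Prod.dist_eq, max_lt_iff]
    refine ⟨ht, ?_⟩
    rw [Real.dist_eq, abs_of_nonneg (by linarith [hr.1])] at *
    simp only
    linarith [hr.2])
  rw [dist_eq_norm] at this
  simpa [flow_zero] using this.le

/-- A mild solution may fail to be differentiable, but `smooth δ` commutes with the flow and maps
into the domain of the generator, so the smoothed solution satisfies the equation classically. -/
theorem hasDerivWithinAt_smooth_mild (g : H) {F : ℝ → H} (hF : Continuous F) {δ s : ℝ}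
    (hδ : 0 < δ) (hs : 0 ≤ s) :
    HasDerivWithinAt (fun t => hU.smooth δ (hU.mild g F t))
      (δ⁻¹ • (hU.flow δ (hU.mild g F s) - hU.mild g F s) + hU.smooth δ (F s)) (Set.Ici s) s := by
  have comm : ∀ {k : ℝ} (_ : 0 ≤ k) (x : H),
      hU.smooth δ (hU.flow k x) = hU.flow k (hU.smooth δ x) := fun {k} hk x => by
    rw [smooth_apply, smooth_apply, map_smul, ← ContinuousLinearMap.intervalIntegral_comp_comm _
      ((hU.continuous_flow_apply x).intervalIntegrable _ _)]
    congr 1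
    refine intervalIntegral.integral_congr fun r hr => ?_
    rw [Set.uIcc_of_le hδ.le] at hr
    rw [← hU.flow_add hr.1 hk, ← hU.flow_add hk hr.1, add_comm]
  have h1 := hU.hasDerivWithinAt_flow_smooth hδ (hU.mild g F s)
  have h1' : HasDerivWithinAt (fun t => hU.flow (t - s) (hU.smooth δ (hU.mild g F s)))
      (δ⁻¹ • (hU.flow δ (hU.mild g F s) - hU.mild g F s)) (Set.Ici s) s := by
    have hsub : HasDerivWithinAt (fun t : ℝ => t - s) 1 (Set.Ici s) s :=
      (hasDerivWithinAt_id s _).sub_const s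
    have := HasDerivWithinAt.scomp_of_eq s h1 hsub (fun t (ht : s ≤ t) => by simpa using ht)
      (sub_self s).symm
    simpa [Function.comp_def] using this
  have h2 := (hU.smooth δ).hasFDerivAt.comp_hasDerivWithinAt s (hU.hasDerivWithinAt_duhamel hF s)
  refine (h1'.add h2).congr (fun t ht => ?_) ?_
  · rw [hU.mild_eq_of_le g hF hs ht, map_add, comm (sub_nonneg.2 ht)]
    rfl
  · simp [flow_zero]

end IsContractionSemigroup

end Semigroup

/-! ### Energy estimates for mild solutions and for the Dyson step. -/

section Energy

namespace IsContractionSemigroup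

variable {H : Type*} [NormedAddCommGroup H] [InnerProductSpace ℝ H] [CompleteSpace H]
variable {U : ℝ≥0 → H →ₗ[ℝ] H} (hU : IsContractionSemigroup U)

/-- Energy inequality for mild solutions: if the symmetric form `⟪x, Q y⟫` and the functional `d`
satisfy `d x ≤ -⟪A x, Q x⟫` on the domain of the generator `A`, then `⟪w, Q w⟫` grows at most at
rate `2 (⟪F, Q w⟫ - d w)` along a mild solution `w` with forcing `F`. -/
theorem energy_mild {Q : H →L[ℝ] H} (hQ : ∀ x y, ⟪Q x, y⟫ = ⟪x, Q y⟫) {d : H → ℝ}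
    (hd : Continuous d) {c : ℝ} (hdc : ∀ x, |d x| ≤ c * ‖x‖ ^ 2)
    (hypo : ∀ z ∈ generatorGraph U, d z.1 ≤ -⟪z.2, Q z.1⟫) (g : H) {F : ℝ → H}
    (hF : Continuous F) {t : ℝ} (ht : 0 ≤ t) :
    ⟪hU.mild g F t, Q (hU.mild g F t)⟫ ≤ ⟪g, Q g⟫ +
      ∫ s in (0 : ℝ)..t, 2 * (⟪F s, Q (hU.mild g F s)⟫ - d (hU.mild g F s)) := by
  set w := hU.mild g F with hw
  have hwc : Continuous w := hU.continuous_mild g hF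
  -- The inequality holds for the smoothed solution, where the hypothesis on the generator graph
  -- applies pointwise in time. It passes to the limit `δ → 0` by dominated convergence, since
  -- smoothing is a contraction.
  have key : ∀ δ > 0, ⟪hU.smooth δ (w t), Q (hU.smooth δ (w t))⟫ ≤
      ⟪hU.smooth δ g, Q (hU.smooth δ g)⟫ +
        ∫ s in (0 : ℝ)..t, 2 * (⟪hU.smooth δ (F s), Q (hU.smooth δ (w s))⟫ -
          d (hU.smooth δ (w s))) := by
    intro δ hδ
    set A : ℝ → H := fun s => δ⁻¹ • (hU.flow δ (w s) - w s) with hA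
    have hder : ∀ s ∈ Set.Ioo (min 0 t) (max 0 t),
        HasDerivWithinAt (fun s => ⟪hU.smooth δ (w s), Q (hU.smooth δ (w s))⟫)
          (2 * ⟪A s + hU.smooth δ (F s), Q (hU.smooth δ (w s))⟫) (Set.Ioi s) s := by
      intro s hs
      rw [min_eq_left ht] at hs
      have h1 := (hU.hasDerivWithinAt_smooth_mild g hF hδ hs.1.le).mono Set.Ioi_subset_Ici_self
      have h2 := Q.hasFDerivAt.comp_hasDerivWithinAt s h1
      have h3 := h1.inner ℝ h2
      refine h3.congr_deriv ?_
      simp only [Function.comp]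
      rw [← hQ, real_inner_comm]
      ring
    have hcont : Continuous fun s => ⟪hU.smooth δ (w s), Q (hU.smooth δ (w s))⟫ := by fun_prop
    have hAc : Continuous A := by fun_prop
    have hftc := intervalIntegral.integral_eq_sub_of_hasDeriv_right
      (hcont.continuousOn (s := Set.uIcc 0 t)) hder
      ((by fun_prop : Continuous fun s =>
        2 * ⟪A s + hU.smooth δ (F s), Q (hU.smooth δ (w s))⟫).intervalIntegrable _ _)
    rw [show w 0 = g from hU.mild_zero g F] at hftc
    have hle : ∫ s in (0 : ℝ)..t, 2 * ⟪A s + hU.smooth δ (F s), Q (hU.smooth δ (w s))⟫ ≤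
        ∫ s in (0 : ℝ)..t, 2 * (⟪hU.smooth δ (F s), Q (hU.smooth δ (w s))⟫ -
          d (hU.smooth δ (w s))) := by
      refine intervalIntegral.integral_mono_on ht
        ((by fun_prop : Continuous _).intervalIntegrable _ _)
        ((by fun_prop : Continuous _).intervalIntegrable _ _) fun s _ => ?_
      have := hypo _ (hU.smooth_mem_generatorGraph hδ (w s))
      simp only at this
      rw [inner_add_left]
      linarith
    linarith
  have l1 : ∀ x : H, Tendsto (fun δ => ⟪hU.smooth δ x, Q (hU.smooth δ x)⟫) (𝓝[>] 0)
      (𝓝 ⟪x, Q x⟫) := fun x =>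
    (hU.tendsto_smooth x).inner ((Q.continuous.tendsto x).comp (hU.tendsto_smooth x))
  have l2 : Tendsto (fun δ => ∫ s in (0 : ℝ)..t, 2 * (⟪hU.smooth δ (F s),
      Q (hU.smooth δ (w s))⟫ - d (hU.smooth δ (w s)))) (𝓝[>] 0)
      (𝓝 (∫ s in (0 : ℝ)..t, 2 * (⟪F s, Q (w s)⟫ - d (w s)))) := by
    refine intervalIntegral.tendsto_integral_filter_of_dominated_convergence
      (fun s => 2 * (‖F s‖ * (‖Q‖ * ‖w s‖) + |c| * ‖w s‖ ^ 2)) ?_ ?_ ?_ ?_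
    · exact Eventually.of_forall fun δ =>
        (by fun_prop : Continuous _).aestronglyMeasurable
    · refine Eventually.of_forall fun δ => Eventually.of_forall fun s _ => ?_
      rw [norm_mul, Real.norm_ofNat]
      refine mul_le_mul_of_nonneg_left ((norm_sub_le _ _).trans (add_le_add ?_ ?_)) zero_le_two
      · refine (norm_inner_le_norm _ _).trans ?_
        gcongr
        · exact hU.norm_smooth_le _ _
        · exact (Q.le_opNorm _).trans (by gcongr; exact hU.norm_smooth_le _ _)
      · refine (hdc _).trans ?_
        gcongr
        · exact le_abs_self c
        · exact hU.norm_smooth_le _ _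
    · exact (by fun_prop : Continuous _).intervalIntegrable _ _
    · refine Eventually.of_forall fun s _ => ?_
      refine (((hU.tendsto_smooth (F s)).inner
        ((Q.continuous.tendsto _).comp (hU.tendsto_smooth (w s)))).sub
        ((hd.tendsto _).comp (hU.tendsto_smooth (w s)))).const_mul 2
  refine le_of_tendsto_of_tendsto (l1 (w t)) ((l1 g).add l2) ?_
  filter_upwards [self_mem_nhdsWithin] with δ hδ
  exact key δ hδ

/-- The first-order Dyson approximation `g ↦ U_h g + ∫₀ʰ U_{h-r} V U_r g dr` of the semigroup
generated by `A + V`. -/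
def dyson (V : H →L[ℝ] H) (h : ℝ) (g : H) : H := hU.mild g (fun r => V (hU.flow r g)) h

/-- The Dyson step solves the equation with forcing `V U_r g` in place of `V w_r`. The two differ by
`O(r)`, which costs only `O(h²)` after integration, so the growth rate at first order is that of the
form bound for `A + V`. -/
theorem dyson_growth {Q V : H →L[ℝ] H} (hQ : ∀ x y, ⟪Q x, y⟫ = ⟪x, Q y⟫) {d : H → ℝ}
    (hd : Continuous d) {c : ℝ} (hdc : ∀ x, |d x| ≤ c * ‖x‖ ^ 2)
    (hypo : ∀ z ∈ generatorGraph U, d z.1 ≤ -⟪z.2, Q z.1⟫) {a : ℝ} (ha : 0 < a)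
    (hQa : ∀ x, a * ‖x‖ ^ 2 ≤ ⟪x, Q x⟫) {κ : ℝ} (hκ : 0 ≤ κ)
    (hform : ∀ x, ⟪V x, Q x⟫ - d x ≤ κ * ⟪x, Q x⟫) :
    ∃ C : ℝ, 0 ≤ C ∧ ∀ h : ℝ, 0 ≤ h → h ≤ 1 → ∀ g : H,
      ⟪hU.dyson V h g, Q (hU.dyson V h g)⟫ ≤ (1 + 2 * κ * h + C * h ^ 2) * ⟪g, Q g⟫ := by
  set m := ‖V‖ with hm
  have hm0 : 0 ≤ m := norm_nonneg _
  set C₁ := m * m * (‖Q‖ * (1 + m)) with hC₁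
  have hC₁0 : 0 ≤ C₁ := by positivity
  set C₂ := 2 * (κ * (‖Q‖ * (1 + m) ^ 2) + C₁) with hC₂
  have hC₂0 : 0 ≤ C₂ := by positivity
  refine ⟨(2 * κ * C₂ + 2 * C₁) / a, by positivity, fun h h0 h1 g => ?_⟩
  set F : ℝ → H := fun r => V (hU.flow r g) with hFdef
  have hF : Continuous F := V.continuous.comp (hU.continuous_flow_apply g)
  have hFn : ∀ r, ‖F r‖ ≤ m * ‖g‖ := fun r =>
    (V.le_opNorm _).trans (by gcongr; exact hU.norm_flow_le _ _)
  set w := hU.mild g F with hw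
  have hwc : Continuous w := hU.continuous_mild g hF
  have e1 : ∀ s, 0 ≤ s → ‖w s - hU.flow s g‖ ≤ m * ‖g‖ * s := fun s hs =>
    hU.norm_mild_sub_flow_le g hs hFn
  have e2 : ∀ s, 0 ≤ s → s ≤ 1 → ‖w s‖ ≤ (1 + m) * ‖g‖ := fun s hs hs1 => by
    have : w s = hU.flow s g + (w s - hU.flow s g) := by abel
    rw [this]
    refine (norm_add_le _ _).trans ?_
    have h2 := hU.norm_flow_le s g
    have h3 : m * ‖g‖ * s ≤ m * ‖g‖ * 1 := by gcongr
    linarith [e1 s hs]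
  have e3 : ∀ s, 0 ≤ s → s ≤ 1 →
      2 * (⟪F s, Q (w s)⟫ - d (w s)) ≤ 2 * κ * ⟪w s, Q (w s)⟫ + 2 * C₁ * s * ‖g‖ ^ 2 := by
    intro s hs hs1
    have h1 : ⟪F s, Q (w s)⟫ = ⟪V (w s), Q (w s)⟫ - ⟪V (w s - hU.flow s g), Q (w s)⟫ := by
      rw [map_sub, inner_sub_left]; ring
    have h2 : |⟪V (w s - hU.flow s g), Q (w s)⟫| ≤ C₁ * s * ‖g‖ ^ 2 := by
      refine (abs_real_inner_le_norm _ _).trans ?_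
      calc ‖V (w s - hU.flow s g)‖ * ‖Q (w s)‖
          ≤ (m * (m * ‖g‖ * s)) * (‖Q‖ * ((1 + m) * ‖g‖)) := by
            gcongr
            · exact (V.le_opNorm _).trans (by gcongr; exact e1 s hs)
            · exact (Q.le_opNorm _).trans (by gcongr; exact e2 s hs hs1)
        _ = C₁ * s * ‖g‖ ^ 2 := by rw [hC₁]; ring
    have h3 := hform (w s)
    have h4 := (abs_le.1 h2).1
    rw [h1]
    linarith
  have e4 : ∀ t, 0 ≤ t → t ≤ 1 → ∀ R : ℝ, (∀ s ∈ Set.Icc 0 t,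
      2 * κ * ⟪w s, Q (w s)⟫ + 2 * C₁ * s * ‖g‖ ^ 2 ≤ R) →
      ⟪w t, Q (w t)⟫ ≤ ⟪g, Q g⟫ + t * R := by
    intro t ht ht1 R hR
    refine (hU.energy_mild hQ hd hdc hypo g hF ht).trans ?_
    gcongr
    calc ∫ s in (0 : ℝ)..t, 2 * (⟪F s, Q (w s)⟫ - d (w s)) ≤ ∫ _ in (0 : ℝ)..t, R := by
          refine intervalIntegral.integral_mono_on ht
            ((by fun_prop : Continuous _).intervalIntegrable _ _) (by simp) fun s hs => ?_
          exact (e3 s hs.1 (hs.2.trans ht1)).trans (hR s hs)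
      _ = t * R := by simp
  -- Bootstrap: this crude bound, first order in `s`, is fed back into `e4` to get the exact
  -- first-order coefficient `2 κ` in `e6`.
  have e5 : ∀ s, 0 ≤ s → s ≤ 1 → ⟪w s, Q (w s)⟫ ≤ ⟪g, Q g⟫ + s * (C₂ * ‖g‖ ^ 2) := by
    intro s hs hs1
    refine e4 s hs hs1 _ fun r hr => ?_
    have h5 : ⟪w r, Q (w r)⟫ ≤ ‖Q‖ * (1 + m) ^ 2 * ‖g‖ ^ 2 := by
      refine (real_inner_le_norm _ _).trans ?_
      have hr1 := e2 r hr.1 (hr.2.trans hs1)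
      calc ‖w r‖ * ‖Q (w r)‖ ≤ ((1 + m) * ‖g‖) * (‖Q‖ * ((1 + m) * ‖g‖)) := by
            gcongr
            exact (Q.le_opNorm _).trans (by gcongr)
        _ = _ := by ring
    have h6 : 2 * C₁ * r * ‖g‖ ^ 2 ≤ 2 * C₁ * 1 * ‖g‖ ^ 2 := by
      gcongr
      exact hr.2.trans hs1
    have h7 : 2 * κ * ⟪w r, Q (w r)⟫ ≤ 2 * κ * (‖Q‖ * (1 + m) ^ 2 * ‖g‖ ^ 2) := by gcongr
    rw [hC₂]
    linarith
  have e6 : ⟪w h, Q (w h)⟫ ≤ ⟪g, Q g⟫ +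
      h * (2 * κ * (⟪g, Q g⟫ + h * (C₂ * ‖g‖ ^ 2)) + 2 * C₁ * h * ‖g‖ ^ 2) := by
    refine e4 h h0 h1 _ fun s hs => ?_
    have h8 := e5 s hs.1 (hs.2.trans h1)
    have h9 : s * (C₂ * ‖g‖ ^ 2) ≤ h * (C₂ * ‖g‖ ^ 2) := by gcongr; exact hs.2
    gcongr
    · exact h8.trans (by linarith)
    · exact hs.2
  -- Coercivity of `Q` turns the second-order remainder into a multiple of the form, so that the
  -- estimate can be iterated.
  have e7 : ‖g‖ ^ 2 ≤ ⟪g, Q g⟫ / a := by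
    rw [le_div_iff₀ ha, mul_comm]
    exact hQa g
  change ⟪w h, Q (w h)⟫ ≤ _
  calc ⟪w h, Q (w h)⟫ ≤ (1 + 2 * κ * h) * ⟪g, Q g⟫ +
        (2 * κ * C₂ + 2 * C₁) * h ^ 2 * ‖g‖ ^ 2 := by linarith
    _ ≤ (1 + 2 * κ * h) * ⟪g, Q g⟫ +
        (2 * κ * C₂ + 2 * C₁) * h ^ 2 * (⟪g, Q g⟫ / a) := by gcongr
    _ = _ := by ring

theorem continuous_dyson_integrand (V : H →L[ℝ] H) (h : ℝ) (g : H) :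
    Continuous fun r => hU.flow r (V (hU.flow (h - r) g)) :=
  hU.continuous_flow_comp continuous_id
    (V.continuous.comp (hU.continuous_flow_comp (continuous_const.sub continuous_id)
      continuous_const))

/-- The Dyson approximation as an average over a uniformly chosen time of perturbation. -/
theorem dyson_eq_integral (V : H →L[ℝ] H) {h : ℝ} (hh : 0 < h) (g : H) :
    h • hU.dyson V h g = ∫ r in (0 : ℝ)..h,
      hU.flow r (hU.flow (h - r) g + h • V (hU.flow (h - r) g)) := by
  have e1 : ∫ r in (0 : ℝ)..h, hU.flow (h - r) (V (hU.flow r g)) =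
      ∫ r in (0 : ℝ)..h, hU.flow r (V (hU.flow (h - r) g)) := by
    have := intervalIntegral.integral_comp_sub_left (a := 0) (b := h)
      (fun r => hU.flow r (V (hU.flow (h - r) g))) h
    simpa using this
  have e2 : ∫ r in (0 : ℝ)..h, hU.flow r (hU.flow (h - r) g + h • V (hU.flow (h - r) g)) =
      ∫ r in (0 : ℝ)..h, (hU.flow h g + h • hU.flow r (V (hU.flow (h - r) g))) := by
    refine intervalIntegral.integral_congr fun r hr => ?_
    rw [Set.uIcc_of_le hh.le] at hr
    simp only [map_add, map_smul]
    rw [← hU.flow_add hr.1 (sub_nonneg.2 hr.2), add_sub_cancel]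
  have hc : Continuous fun r => h • hU.flow r (V (hU.flow (h - r) g)) :=
    (hU.continuous_dyson_integrand V h g).const_smul h
  rw [e2, intervalIntegral.integral_add (by simp)
    (hc.intervalIntegrable _ _), intervalIntegral.integral_smul,
    intervalIntegral.integral_const, dyson, mild, e1, smul_add, sub_zero]

end IsContractionSemigroup

end Energy

/-! ### The semigroup of a Markov process -/

theorem integral_bind_kernel {α β : Type*} [MeasurableSpace α] [MeasurableSpace β] {m : Measure α}
    {κ : Kernel α β} {f : β → ℝ} (hf : Integrable f (m.bind κ)) :
    ∫ y, f y ∂(m.bind κ) = ∫ x, ∫ y, f y ∂(κ x) ∂m := by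
  rw [Measure.comp_eq_comp_const_apply] at hf ⊢
  rw [Kernel.integral_comp hf, Kernel.const_apply]

theorem memLp_bounded_mul {E : Type*} [MeasurableSpace E] {μ : Measure E} {V : E → ℝ}
    (hV : Measurable V) {m : ℝ} (hm : ∀ᵐ x ∂μ, |V x| ≤ m) (g : Lp ℝ 2 μ) :
    MemLp (fun x => V x * g x) 2 μ := by
  refine (Lp.memLp g).of_le_mul (c := m)
    (hV.aestronglyMeasurable.mul (Lp.stronglyMeasurable g).aestronglyMeasurable) ?_
  filter_upwards [hm] with x hx
  rw [norm_mul]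
  exact mul_le_mul_of_nonneg_right hx (norm_nonneg _)

/-- Multiplication by an essentially bounded function, as an operator on `L²`. -/
def mulOp {E : Type*} [MeasurableSpace E] {μ : Measure E} (V : E → ℝ) (hV : Measurable V) (m : ℝ)
    (hm : ∀ᵐ x ∂μ, |V x| ≤ m) : Lp ℝ 2 μ →L[ℝ] Lp ℝ 2 μ :=
  LinearMap.mkContinuous
    { toFun := fun g => (memLp_bounded_mul hV hm g).toLp _
      map_add' := fun f g => by
        rw [← MemLp.toLp_add]
        apply MemLp.toLp_congr
        filter_upwards [Lp.coeFn_add f g] with x hx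
        rw [hx, Pi.add_apply, Pi.add_apply]
        ring
      map_smul' := fun c f => by
        rw [RingHom.id_apply, ← MemLp.toLp_const_smul]
        apply MemLp.toLp_congr
        filter_upwards [Lp.coeFn_smul c f] with x hx
        rw [hx, Pi.smul_apply, Pi.smul_apply, smul_eq_mul, smul_eq_mul]
        ring } m fun g => by
    refine Lp.norm_le_mul_norm_of_ae_le_mul ?_
    filter_upwards [(memLp_bounded_mul hV hm g).coeFn_toLp, hm] with x hx hmx
    change ‖(memLp_bounded_mul hV hm g).toLp _ x‖ ≤ _
    rw [hx, norm_mul]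
    exact mul_le_mul_of_nonneg_right hmx (norm_nonneg _)

theorem mulOp_apply {E : Type*} [MeasurableSpace E] {μ : Measure E} (V : E → ℝ)
    (hV : Measurable V) (m : ℝ) (hm : ∀ᵐ x ∂μ, |V x| ≤ m) (g : Lp ℝ 2 μ) :
    mulOp V hV m hm g =ᵐ[μ] fun x => V x * g x :=
  (memLp_bounded_mul hV hm g).coeFn_toLp

namespace MarkovProcess

variable {E Ω : Type*} [MeasurableSpace E] [mΩ : MeasurableSpace Ω] (M : MarkovProcess E Ω)

instance (μ : Measure E) [IsProbabilityMeasure μ] : IsProbabilityMeasure (M.lawFrom μ) := by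
  unfold lawFrom
  infer_instance

theorem transition_apply (t : ℝ≥0) (x : E) {S : Set E} (hS : MeasurableSet S) :
    M.transition t x S = M.law x (M.X t ⁻¹' S) := by
  rw [transition, Kernel.map_apply' _ (M.measurable_X t) _ hS]

theorem law_inter_eq (x : E) (s t : ℝ≥0) {S : Set E} (hS : MeasurableSet S) {A : Set Ω}
    (hA : MeasurableSet[M.filtration s] A) :
    M.law x (A ∩ M.X (s + t) ⁻¹' S) = ∫⁻ ω in A, M.transition t (M.X s ω) S ∂(M.law x) := by
  have hA' : MeasurableSet A := M.filtration.le s _ hA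
  have hXS : MeasurableSet (M.X (s + t) ⁻¹' S) := M.measurable_X _ hS
  have h1 := setIntegral_condExp (μ := M.law x) (M.filtration.le s)
    (f := (M.X (s + t) ⁻¹' S).indicator fun _ => (1 : ℝ))
    ((integrable_const 1).indicator hXS) hA
  rw [setIntegral_congr_ae hA' ((M.markov x s t S hS).mono fun ω h _ => h),
    setIntegral_indicator hXS] at h1
  have hm : Measurable fun ω => M.transition t (M.X s ω) S :=
    (Kernel.measurable_coe _ hS).comp (M.measurable_X s)
  have h2 : ∀ ω, (M.law (M.X s ω)).real (M.X t ⁻¹' S) = (M.transition t (M.X s ω) S).toReal :=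
    fun ω => by rw [measureReal_def, M.transition_apply t _ hS]
  simp only [h2] at h1
  rw [integral_toReal hm.aemeasurable (Eventually.of_forall fun ω => measure_lt_top _ _)] at h1
  simp only [integral_const, measureReal_def, Measure.restrict_apply_univ, smul_eq_mul,
    mul_one] at h1
  refine ((ENNReal.toReal_eq_toReal_iff' ?_ (measure_ne_top _ _)).1 h1).symm
  refine ne_of_lt (lt_of_le_of_lt (lintegral_mono fun ω => prob_le_one) ?_)
  simp

theorem lawFrom_inter_eq (μ : Measure E) (s t : ℝ≥0) {S : Set E} (hS : MeasurableSet S) {A : Set Ω}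
    (hA : MeasurableSet[M.filtration s] A) :
    M.lawFrom μ (A ∩ M.X (s + t) ⁻¹' S) =
      ∫⁻ ω in A, M.transition t (M.X s ω) S ∂(M.lawFrom μ) := by
  have hA' : MeasurableSet A := M.filtration.le s _ hA
  have hm : Measurable fun ω => M.transition t (M.X s ω) S :=
    (Kernel.measurable_coe _ hS).comp (M.measurable_X s)
  rw [lawFrom, Measure.bind_apply (hA'.inter (M.measurable_X _ hS)) M.law.measurable.aemeasurable,
    ← lintegral_indicator hA', Measure.lintegral_bind M.law.measurable.aemeasurable
      (hm.indicator hA').aemeasurable]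
  refine lintegral_congr fun x => ?_
  rw [M.law_inter_eq x s t hS hA, lintegral_indicator hA']

/-- Extends the Markov property from events of the past to nonnegative weights by the monotone class
induction. -/
theorem lintegral_mul_indicator_eq (μ : Measure E) (s t : ℝ≥0) {S : Set E} (hS : MeasurableSet S)
    {Z : Ω → ℝ≥0∞} (hZ : Measurable[M.filtration s] Z) :
    ∫⁻ ω in M.X (s + t) ⁻¹' S, Z ω ∂(M.lawFrom μ) =
      ∫⁻ ω, Z ω * M.transition t (M.X s ω) S ∂(M.lawFrom μ) := by
  have hm : Measurable fun ω => M.transition t (M.X s ω) S :=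
    (Kernel.measurable_coe _ hS).comp (M.measurable_X s)
  have hle := M.filtration.le s
  refine Measurable.ennreal_induction (mα := M.filtration s) (motive := fun Z : Ω → ℝ≥0∞ =>
    ∫⁻ ω in M.X (s + t) ⁻¹' S, Z ω ∂(M.lawFrom μ) =
      ∫⁻ ω, Z ω * M.transition t (M.X s ω) S ∂(M.lawFrom μ)) ?_ ?_ ?_ hZ
  · intro c A hA
    have hA' : MeasurableSet A := hle _ hA
    have e : ∀ ω, A.indicator (fun _ => c) ω * M.transition t (M.X s ω) S =
        A.indicator (fun ω => c * M.transition t (M.X s ω) S) ω := fun ω => by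
      by_cases h : ω ∈ A <;> simp [h]
    simp only [e]
    rw [lintegral_indicator hA', lintegral_indicator hA', lintegral_const_mul _ hm,
      ← M.lawFrom_inter_eq μ s t hS hA]
    simp [Measure.restrict_apply hA']
  · intro f g _ hf hg ihf ihg
    have hf' : Measurable f := hf.mono hle le_rfl
    simp only [Pi.add_apply, add_mul]
    rw [lintegral_add_left hf', lintegral_add_left
      (show Measurable fun ω => f ω * M.transition t (M.X s ω) S from hf'.mul hm), ihf, ihg]
  · intro f hf hmono ih
    have hf' : ∀ n, Measurable (f n) := fun n => (hf n).mono hle le_rfl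
    simp only [ENNReal.iSup_mul]
    rw [lintegral_iSup hf' hmono, lintegral_iSup
      (fun n => show Measurable fun ω => f n ω * M.transition t (M.X s ω) S from (hf' n).mul hm)
      (fun i j hij ω => mul_le_mul_left (hmono hij ω) _)]
    simp only [ih]

/-- The Markov property as an identity of measures: a weight from the past changes the law at time
`s`, and the kernel then transports it. In this form it can be tested on any integrable function,
signed ones included. -/
theorem map_withDensity_eq_bind (μ : Measure E) (s t : ℝ≥0)
    {Z : Ω → ℝ≥0∞} (hZ : Measurable[M.filtration s] Z) :
    ((M.lawFrom μ).withDensity Z).map (M.X (s + t)) =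
      (((M.lawFrom μ).withDensity Z).map (M.X s)).bind (M.transition t) := by
  refine Measure.ext fun S hS => ?_
  have hZ' : Measurable Z := hZ.mono (M.filtration.le s) le_rfl
  have hm : Measurable fun x => M.transition t x S := Kernel.measurable_coe _ hS
  rw [Measure.map_apply (M.measurable_X _) hS, withDensity_apply _ (M.measurable_X _ hS),
    M.lintegral_mul_indicator_eq μ s t hS hZ,
    Measure.bind_apply hS (M.transition t).measurable.aemeasurable,
    lintegral_map hm (M.measurable_X s),
    lintegral_withDensity_eq_lintegral_mul _ hZ'
      (show Measurable fun ω => M.transition t (M.X s ω) S from hm.comp (M.measurable_X s))]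
  rfl

theorem transition_add (s t : ℝ≥0) (x : E) :
    M.transition (s + t) x = (M.transition s x).bind (M.transition t) := by
  refine Measure.ext fun S hS => ?_
  have h := M.law_inter_eq x s t hS (A := Set.univ) MeasurableSet.univ
  rw [Set.univ_inter, Measure.restrict_univ] at h
  rw [M.transition_apply _ _ hS, h, Measure.bind_apply hS (M.transition t).measurable.aemeasurable]
  conv_rhs => rw [transition, Kernel.map_apply _ (M.measurable_X s)]
  rw [lintegral_map (Kernel.measurable_coe _ hS) (M.measurable_X s)]

theorem transition_zero (x : E) : M.transition 0 x = Measure.dirac x := by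
  rw [transition, Kernel.map_apply _ (M.measurable_X 0), M.initial]

variable {M} {μ : Measure E} [IsProbabilityMeasure μ]

theorem Invariant.measurePreserving (h : M.Invariant μ) (s : ℝ≥0) :
    MeasurePreserving (M.X s) (M.lawFrom μ) μ := by
  refine ⟨M.measurable_X s, Measure.ext fun S hS => ?_⟩
  have h1 : (μ.bind (M.transition s)) S = μ S := by rw [(h s).def]
  rw [← h1, Measure.map_apply (M.measurable_X s) hS, lawFrom,
    Measure.bind_apply (M.measurable_X s hS) M.law.measurable.aemeasurable,
    Measure.bind_apply hS (M.transition s).measurable.aemeasurable]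
  exact lintegral_congr fun x => (M.transition_apply s x hS).symm

/-- The map `g ↦ g(X_s)` from `L²(μ)` to `L²(P^μ)`. -/
def pull (h : M.Invariant μ) (s : ℝ≥0) : Lp ℝ 2 μ →ₗᵢ[ℝ] Lp ℝ 2 (M.lawFrom μ) :=
  Lp.compMeasurePreservingₗᵢ ℝ (M.X s) (h.measurePreserving s)

theorem pull_apply (h : M.Invariant μ) (s : ℝ≥0) (g : Lp ℝ 2 μ) :
    pull h s g =ᵐ[M.lawFrom μ] fun ω => g (M.X s ω) :=
  Lp.coeFn_compMeasurePreserving g (h.measurePreserving s)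

/-- Both sides are the stationary correlation `E[φ(X_0) g(X_s)]`. Since `pull` is isometric,
contraction of the semigroup becomes Cauchy–Schwarz. -/
theorem inner_semigroup (h : M.Invariant μ) (s : ℝ≥0) (φ g : Lp ℝ 2 μ) :
    ⟪φ, semigroup h s g⟫ = ⟪pull h 0 φ, pull h s g⟫ := by
  have hint : Integrable (fun ω => φ (M.X 0 ω) * g (M.X s ω)) (μ.bind M.law) := by
    have := L2.integrable_inner (𝕜 := ℝ) (pull h 0 φ) (pull h s g)
    refine this.congr ?_
    filter_upwards [pull_apply h 0 φ, pull_apply h s g] with ω h1 h2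
    rw [h1, h2, RCLike.inner_apply, conj_trivial, mul_comm]
  have e1 : ⟪pull h 0 φ, pull h s g⟫ =
      ∫ ω, φ (M.X 0 ω) * g (M.X s ω) ∂(μ.bind M.law) := by
    rw [L2.inner_def]
    refine integral_congr_ae ?_
    filter_upwards [pull_apply h 0 φ, pull_apply h s g] with ω h1 h2
    rw [h1, h2, RCLike.inner_apply, conj_trivial, mul_comm]
  rw [e1, integral_bind_kernel hint, L2.inner_def]
  refine integral_congr_ae ?_
  filter_upwards [semigroup_apply h s g] with x hx
  rw [hx, RCLike.inner_apply, conj_trivial, mul_comm, ← integral_const_mul]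
  refine integral_congr_ae ?_
  have h0 : ∀ᵐ y ∂((M.law x).map (M.X 0)), φ y = φ x := by
    rw [M.initial, ae_dirac_iff]
    exact (Lp.stronglyMeasurable φ).measurable (measurableSet_singleton _)
  filter_upwards [ae_of_ae_map (M.measurable_X 0).aemeasurable h0] with ω hω
  rw [hω]

theorem isContractionSemigroup (h : M.Invariant μ) (hc : StronglyContinuous h) :
    IsContractionSemigroup (semigroup h) where
  zero f := by
    refine Lp.ext ?_
    refine (kernelOp_apply (M.transition 0) (h 0) f).trans (Eventually.of_forall fun x => ?_)
    simp only [M.transition_zero]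
    exact integral_dirac' _ _ (Lp.stronglyMeasurable f)
  add s t f := by
    refine Lp.ext ?_
    refine (kernelOp_apply (M.transition (s + t)) (h (s + t)) f).trans ?_
    refine EventuallyEq.trans ?_
      ((kernelOp_apply (M.transition s) (h s) (semigroup h t f)).trans
        (average_congr (h s) (kernelOp_apply (M.transition t) (h t) f))).symm
    filter_upwards [ae_integrable (h (s + t)) f] with x hx
    rw [M.transition_add] at hx ⊢
    exact integral_bind_kernel hx
  contraction t f := by
    have h1 := inner_semigroup h t (semigroup h t f) f
    have h2 := real_inner_le_norm (pull h 0 (semigroup h t f)) (pull h t f)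
    rw [← h1, LinearIsometry.norm_map, LinearIsometry.norm_map, real_inner_self_eq_norm_sq] at h2
    by_contra! h3
    have h4 := norm_nonneg f
    nlinarith
  tendsto f := hc f

/-- The Markov property for square integrable observables. -/
theorem integral_mul_semigroup (h : M.Invariant μ) (s t : ℝ≥0) {Z : Ω → ℝ}
    (hZ : Measurable[M.filtration s] Z) (hZ0 : ∀ ω, 0 ≤ Z ω) {c : ℝ} (hZc : ∀ ω, Z ω ≤ c)
    (g : Lp ℝ 2 μ) :
    ∫ ω, Z ω * g (M.X (s + t) ω) ∂(M.lawFrom μ) =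
      ∫ ω, Z ω * semigroup h t g (M.X s ω) ∂(M.lawFrom μ) := by
  set P := M.lawFrom μ
  set Z' : Ω → ℝ≥0∞ := fun ω => ENNReal.ofReal (Z ω) with hZ'
  have hZm : Measurable Z := hZ.mono (M.filtration.le s) le_rfl
  have hZ'm : Measurable Z' := hZm.ennreal_ofReal
  -- Absorbing `Z` into the measure turns both sides into integrals against weighted marginal laws.
  have hd : ∀ (r : ℝ≥0) (f : E → ℝ), Measurable f →
      ∫ ω, Z ω * f (M.X r ω) ∂P = ∫ x, f x ∂((P.withDensity Z').map (M.X r)) := by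
    intro r f hf
    rw [integral_map (M.measurable_X r).aemeasurable hf.aestronglyMeasurable,
      integral_withDensity_eq_integral_toReal_smul hZ'm
        (Eventually.of_forall fun ω => ENNReal.ofReal_lt_top)]
    refine integral_congr_ae (Eventually.of_forall fun ω => ?_)
    simp only [hZ', ENNReal.toReal_ofReal (hZ0 ω), smul_eq_mul]
  have hgm : Measurable g := (Lp.stronglyMeasurable g).measurable
  have hint : Integrable g ((P.withDensity Z').map (M.X (s + t))) := by
    rw [integrable_map_measure hgm.aestronglyMeasurable (M.measurable_X _).aemeasurable,
      integrable_withDensity_iff_integrable_smul' hZ'm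
        (Eventually.of_forall fun ω => ENNReal.ofReal_lt_top)]
    have hg : Integrable (fun ω => g (M.X (s + t) ω)) P :=
      (h.measurePreserving (s + t)).integrable_comp_of_integrable
        ((Lp.memLp g).integrable (by norm_num))
    refine hg.bdd_mul (c := c) hZ'm.ennreal_toReal.aestronglyMeasurable
      (Eventually.of_forall fun ω => ?_)
    simp only [hZ', ENNReal.toReal_ofReal (hZ0 ω), Real.norm_eq_abs, abs_of_nonneg (hZ0 ω)]
    exact hZc ω
  have hkm : Measurable fun x => ∫ y, g y ∂(M.transition t x) :=
    ((Lp.stronglyMeasurable g).integral_kernel (κ := M.transition t)).measurable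
  rw [hd _ _ hgm]
  rw [M.map_withDensity_eq_bind μ s t hZ.ennreal_ofReal] at hint ⊢
  rw [integral_bind_kernel hint, ← hd _ _ hkm]
  refine integral_congr_ae ?_
  filter_upwards [(h.measurePreserving s).quasiMeasurePreserving.ae
    (kernelOp_apply (M.transition t) (h t) g)] with ω hω
  rw [← hω]
  rfl

end MarkovProcess

/-! ### The modified scalar product -/

section Modifier

variable {H : Type*} [NormedAddCommGroup H] [InnerProductSpace ℝ H] [CompleteSpace H]

theorem mem_antisymmPart_domain {A : H →ₗ.[ℝ] H} {x : H} (h1 : x ∈ A.domain)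
    (h2 : x ∈ A.adjoint.domain) : x ∈ (antisymmPart A).domain := ⟨h1, h2⟩

theorem antisymmPart_apply (A : H →ₗ.[ℝ] H) (x : (antisymmPart A).domain) :
    antisymmPart A x = (2⁻¹ : ℝ) • (A ⟨x, x.2.1⟩ - A.adjoint ⟨x, x.2.2⟩) := rfl

/-- A vector fixed by the semigroup and by its adjoint is killed by the generator and by the adjoint
of the generator. Applied to the constant function, this says that `1` is stationary and `μ`
invariant. -/
theorem antisymmPart_annihilates {U : ℝ≥0 → H →ₗ[ℝ] H} (hU : IsContractionSemigroup U) {e : H}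
    (he : ∀ t, U t e = e) (he' : ∀ t g, ⟪e, U t g⟫ = ⟪e, g⟫) :
    (∃ h : e ∈ (antisymmPart (generator U)).domain, antisymmPart (generator U) ⟨e, h⟩ = 0) ∧
      ∀ x : (antisymmPart (generator U)).domain, ⟪e, antisymmPart (generator U) x⟫ = 0 := by
  have hdense := hU.dense_generator_domain
  have hg : (e, (0 : H)) ∈ (generator U).graph := by
    rw [generator_graph]
    change Tendsto (fun t : ℝ≥0 => (t : ℝ)⁻¹ • (U t e - e)) (𝓝[>] 0) (𝓝 0)
    simp [he]
  obtain ⟨⟨y, hy⟩, hy1, hy2⟩ := (LinearPMap.mem_graph_iff _).1 hg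
  obtain rfl : y = e := hy1
  have hA : ∀ x : (generator U).domain, ⟪y, generator U x⟫ = 0 := by
    intro x
    have hx := (generator U).mem_graph x
    rw [generator_graph] at hx
    have hx' : Tendsto (fun t : ℝ≥0 => (t : ℝ)⁻¹ • (U t x - (x : H))) (𝓝[>] 0)
      (𝓝 (generator U x)) := hx
    have h1 := (tendsto_const_nhds (x := y)).inner (𝕜 := ℝ) hx'
    refine tendsto_nhds_unique h1 (tendsto_const_nhds.congr fun t => ?_)
    rw [inner_smul_right, inner_sub_right, he', sub_self, mul_zero]
  have hA0 : ∀ x : (generator U).domain, ⟪(0 : H), (x : H)⟫ = ⟪y, generator U x⟫ := fun x => by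
    rw [hA, inner_zero_left]
  have hadj : y ∈ (generator U).adjoint.domain :=
    LinearPMap.mem_adjoint_domain_of_exists _ ⟨0, hA0⟩
  have hadj0 : (generator U).adjoint ⟨y, hadj⟩ = 0 :=
    LinearPMap.adjoint_apply_eq hdense _ hA0
  refine ⟨⟨mem_antisymmPart_domain hy hadj, ?_⟩, fun x => ?_⟩
  · rw [antisymmPart_apply, hadj0, hy2]
    simp
  · rw [antisymmPart_apply, inner_smul_right, inner_sub_right, hA,
      real_inner_comm ((generator U).adjoint _) y,
      LinearPMap.adjoint_isFormalAdjoint hdense ⟨x, x.2.2⟩ ⟨y, hy⟩, hy2]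
    simp

variable {C : H →ₗ.[ℝ] H} (hd : Dense (C.domain : Set H)) (hC : C.IsClosable)

theorem isModifier_modifier : IsModifier C (modifier C hd hC) :=
  (existsUnique_isModifier C hd hC).choose_spec.1

/-- With `u = B f` and `y = C u`, the defining equation reads `C* (y + f) = -u`. Pairing with `u`
gives `‖u‖² = -‖y‖² - ⟪f, y⟫ ≤ ‖f‖² / 4`. Density of the domain of `C*` extends the bound to all
`f`. -/
theorem norm_modifier_le (f : H) : ‖modifier C hd hC f‖ ≤ ‖f‖ / 2 := by
  have hcl : IsClosed {f : H | ‖modifier C hd hC f‖ ≤ ‖f‖ / 2} :=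
    isClosed_le (by fun_prop) (by fun_prop)
  refine (closure_minimal (fun f hf => ?_) hcl) (dense_adjoint_domain C hd hC f)
  obtain ⟨hu, hv, h⟩ := isModifier_modifier hd hC ⟨f, hf⟩
  set u := modifier C hd hC f
  set y := C.closure ⟨u, hu⟩
  change ‖u‖ ≤ ‖f‖ / 2
  have e := adjoint_closure C hd hC (⟨y, hv⟩ + ⟨f, hf⟩) ⟨u, hu⟩
  have e1 : C.adjoint (⟨y, hv⟩ + ⟨f, hf⟩) = -u := by
    rw [LinearPMap.map_add, eq_neg_iff_add_eq_zero, ← sub_eq_zero.2 h]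
    simp only [sub_neg_eq_add]
    change _ + _ + u = u + _ + _
    abel
  rw [e1] at e
  change ⟪-u, u⟫ = ⟪y + f, y⟫ at e
  rw [inner_neg_left, inner_add_left, real_inner_self_eq_norm_sq, real_inner_self_eq_norm_sq] at e
  have h3 := neg_le_of_abs_le (abs_real_inner_le_norm f y)
  refine abs_le_of_sq_le_sq' ?_ (by positivity) |>.2
  nlinarith [sq_nonneg (‖f‖ - 2 * ‖y‖)]

/-- Here `C* e = 0`, so `u = B e` solves `u + C* C u = 0`. Pairing with `u` forces `u = 0`. -/
theorem modifier_apply_eq_zero {e : H} (he : ∀ x : C.domain, ⟪e, C x⟫ = 0) :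
    modifier C hd hC e = 0 := by
  have h0 : ∀ x : C.domain, ⟪(0 : H), (x : H)⟫ = ⟪e, C x⟫ := fun x => by
    rw [he, inner_zero_left]
  have hadj : e ∈ C.adjoint.domain := LinearPMap.mem_adjoint_domain_of_exists _ ⟨0, h0⟩
  have hadj0 : C.adjoint ⟨e, hadj⟩ = 0 := LinearPMap.adjoint_apply_eq hd _ h0
  obtain ⟨hu, hv, h⟩ := isModifier_modifier hd hC ⟨e, hadj⟩
  rw [hadj0, neg_zero] at h
  have e1 := adjoint_closure C hd hC ⟨_, hv⟩ ⟨_, hu⟩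
  rw [← neg_eq_of_add_eq_zero_right h, inner_neg_left, real_inner_self_eq_norm_sq,
    real_inner_self_eq_norm_sq] at e1
  have h4 : ‖modifier C hd hC e‖ ^ 2 = 0 := by
    change -‖modifier C hd hC e‖ ^ 2 = _ at e1
    nlinarith [sq_nonneg ‖modifier C hd hC e‖, sq_nonneg ‖C.closure ⟨_, hu⟩‖]
  simpa using h4

/-- On the domain of `C*`, values of `B` lie in the range of `C*`, which is orthogonal to the kernel
of `C`. -/
theorem adjoint_modifier_apply_eq_zero {e : H} (he : e ∈ C.domain) (he0 : C ⟨e, he⟩ = 0) :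
    ContinuousLinearMap.adjoint (modifier C hd hC) e = 0 := by
  have key : ∀ f, ⟪e, modifier C hd hC f⟫ = 0 := by
    intro f
    have hcl : IsClosed {f : H | ⟪e, modifier C hd hC f⟫ = 0} :=
      isClosed_eq (by fun_prop) (by fun_prop)
    refine (closure_minimal (fun f hf => ?_) hcl) (dense_adjoint_domain C hd hC f)
    obtain ⟨hu, hv, h⟩ := isModifier_modifier hd hC ⟨f, hf⟩
    have hformal : ∀ w : C.adjoint.domain, ⟪e, C.adjoint w⟫ = 0 := fun w => by
      rw [real_inner_comm, LinearPMap.adjoint_isFormalAdjoint hd w ⟨e, he⟩, he0, inner_zero_right]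
    have h1 := congrArg (fun z => ⟪e, z⟫) h
    simp only [inner_add_right, inner_neg_right, hformal, add_zero, neg_zero] at h1
    exact h1
  have h2 := key (ContinuousLinearMap.adjoint (modifier C hd hC) e)
  rw [← ContinuousLinearMap.adjoint_inner_left, real_inner_self_eq_norm_sq] at h2
  simpa using h2

/-- The operator `I + ε (B + B*)` representing the modified scalar product. -/
def modMetric (ε : ℝ) (B : H →L[ℝ] H) : H →L[ℝ] H :=
  ContinuousLinearMap.id ℝ H + ε • (B + ContinuousLinearMap.adjoint B)

theorem modMetric_apply (ε : ℝ) (B : H →L[ℝ] H) (x : H) :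
    modMetric ε B x = x + ε • (B x + ContinuousLinearMap.adjoint B x) := rfl

theorem modInner_eq_inner (ε : ℝ) (B : H →L[ℝ] H) (f g : H) :
    modInner ε B f g = ⟪f, modMetric ε B g⟫ := by
  rw [modInner, modMetric_apply, inner_add_right, inner_smul_right]
  rfl

theorem modMetric_symm (ε : ℝ) (B : H →L[ℝ] H) (x y : H) :
    ⟪modMetric ε B x, y⟫ = ⟪x, modMetric ε B y⟫ := by
  simp only [modMetric_apply, inner_add_left, inner_add_right, inner_smul_left, inner_smul_right,
    ContinuousLinearMap.adjoint_inner_left, ContinuousLinearMap.adjoint_inner_right, conj_trivial]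
  ring

theorem norm_symmetrized_le {B : H →L[ℝ] H} (hB : ∀ x, ‖B x‖ ≤ ‖x‖ / 2) (x : H) :
    ‖B x + ContinuousLinearMap.adjoint B x‖ ≤ ‖x‖ := by
  have h1 : ‖B‖ ≤ 1 / 2 := B.opNorm_le_bound (by norm_num) fun x => by linarith [hB x]
  have h2 : ‖ContinuousLinearMap.adjoint B‖ ≤ 1 / 2 := by
    rwa [LinearIsometryEquiv.norm_map]
  have h3 := (ContinuousLinearMap.adjoint B).le_of_opNorm_le h2 x
  linarith [norm_add_le (B x) (ContinuousLinearMap.adjoint B x), hB x]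

theorem norm_modMetric_le {ε : ℝ} (hε : 0 ≤ ε) {B : H →L[ℝ] H} (hB : ∀ x, ‖B x‖ ≤ ‖x‖ / 2)
    (x : H) : ‖modMetric ε B x‖ ≤ (1 + ε) * ‖x‖ := by
  rw [modMetric_apply]
  refine (norm_add_le _ _).trans ?_
  rw [norm_smul, Real.norm_of_nonneg hε, add_mul, one_mul]
  gcongr
  exact norm_symmetrized_le hB x

theorem le_inner_modMetric {ε : ℝ} (hε : 0 ≤ ε) {B : H →L[ℝ] H} (hB : ∀ x, ‖B x‖ ≤ ‖x‖ / 2)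
    (x : H) : (1 - ε) * ‖x‖ ^ 2 ≤ ⟪x, modMetric ε B x⟫ := by
  rw [modMetric_apply, inner_add_right, inner_smul_right, real_inner_self_eq_norm_sq]
  have h1 := neg_le_of_abs_le
    (abs_real_inner_le_norm x (B x + ContinuousLinearMap.adjoint B x))
  have h2 : ‖x‖ * ‖B x + ContinuousLinearMap.adjoint B x‖ ≤ ‖x‖ * ‖x‖ := by
    gcongr
    exact norm_symmetrized_le hB x
  nlinarith

/-- The perturbed form bound: a bounded symmetric perturbation `V` that is centred at the unit
vector `e` is controlled by the coercivity on the complement of `e`. -/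
theorem perturbed_form_le {ε : ℝ} (hε₀ : 0 < ε) (hε₁ : ε < 1) {B : H →L[ℝ] H}
    (hB : ∀ x, ‖B x‖ ≤ ‖x‖ / 2) {e : H} (he : ‖e‖ = 1) (hBe : B e = 0)
    (hBe' : ContinuousLinearMap.adjoint B e = 0) {V : H →L[ℝ] H}
    (hV : ∀ x y, ⟪V x, y⟫ = ⟪x, V y⟫) (hVe : ⟪V e, e⟫ = 0) {m Λ : ℝ} (hm0 : 0 ≤ m)
    (hm : ∀ x, ‖V x‖ ≤ m * ‖x‖) (hΛ : m * (1 + ε) < Λ) (g : H) :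
    ⟪V g, modMetric ε B g⟫ - Λ * ‖g - ⟪e, g⟫ • e‖ ^ 2 ≤
      ‖V e‖ ^ 2 * (1 + ε / 2) ^ 2 / (Λ - m * (1 + ε)) * ⟪g, modMetric ε B g⟫ := by
  set Q := modMetric ε B with hQ
  set c := ⟪e, g⟫ with hc
  set k := g - c • e with hk
  have hQe : Q e = e := by rw [hQ, modMetric_apply, hBe, hBe']; simp
  have hgk : g = c • e + k := by rw [hk]; abel
  have hek : ⟪e, k⟫ = 0 := by
    rw [hk, inner_sub_right, inner_smul_right, real_inner_self_eq_norm_sq, he, ← hc]; ring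
  have hee : ⟪e, e⟫ = 1 := by rw [real_inner_self_eq_norm_sq, he, one_pow]
  have heQk : ⟪e, Q k⟫ = 0 := by rw [← modMetric_symm, ← hQ, hQe, hek]
  have hq : ⟪g, Q g⟫ = c ^ 2 + ⟪k, Q k⟫ := by
    rw [hgk]
    simp only [map_add, map_smul, inner_add_left, inner_add_right, inner_smul_left,
      inner_smul_right, hQe, hee, heQk, real_inner_comm e k, hek, conj_trivial]
    ring
  have hqk : 0 ≤ ⟪k, Q k⟫ := le_trans (by have := sub_pos.2 hε₁; positivity)
    (le_inner_modMetric hε₀.le hB k)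
  -- The `c²` term is `⟪V e, e⟫`, which vanishes because `V` is centred. This is why the bound is
  -- quadratic in `V e`.
  have hVg : ⟪V g, Q g⟫ = c * ⟪V e, Q k + k⟫ + ⟪V k, Q k⟫ := by
    have h1 : ⟪V k, e⟫ = ⟪V e, k⟫ := by rw [hV, real_inner_comm]
    rw [hgk]
    simp only [map_add, map_smul, inner_add_left, inner_add_right, inner_smul_left,
      inner_smul_right, hQe, hVe, h1, conj_trivial]
    ring
  have b1 : ⟪V k, Q k⟫ ≤ m * (1 + ε) * ‖k‖ ^ 2 := by
    refine (real_inner_le_norm _ _).trans ?_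
    calc ‖V k‖ * ‖Q k‖ ≤ (m * ‖k‖) * ((1 + ε) * ‖k‖) := by
          gcongr
          · exact hm k
          · exact norm_modMetric_le hε₀.le hB k
      _ = _ := by ring
  have b2 : c * ⟪V e, Q k + k⟫ ≤ |c| * (‖V e‖ * ((2 + ε) * ‖k‖)) := by
    refine (le_abs_self _).trans ?_
    rw [abs_mul]
    gcongr
    refine (abs_real_inner_le_norm _ _).trans ?_
    gcongr
    refine (norm_add_le _ _).trans ?_
    linarith [norm_modMetric_le hε₀.le hB k]
  have hD : 0 < Λ - m * (1 + ε) := sub_pos.2 hΛ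
  set D := Λ - m * (1 + ε) with hDdef
  -- Maximum over `‖k‖`, by completing the square. The part `D` of `Λ` is what remains after paying
  -- for `⟪V k, Q k⟫`.
  have b3 : |c| * (‖V e‖ * ((2 + ε) * ‖k‖)) - D * ‖k‖ ^ 2 ≤
      ‖V e‖ ^ 2 * (1 + ε / 2) ^ 2 / D * c ^ 2 := by
    rw [div_mul_eq_mul_div, le_div_iff₀ hD, ← sq_abs c]
    nlinarith [sq_nonneg (|c| * ‖V e‖ * (1 + ε / 2) - D * ‖k‖)]
  have b4 : ‖V e‖ ^ 2 * (1 + ε / 2) ^ 2 / D * c ^ 2 ≤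
      ‖V e‖ ^ 2 * (1 + ε / 2) ^ 2 / D * ⟪g, Q g⟫ := by
    rw [hq]
    gcongr
    linarith
  rw [hVg]
  have : Λ * ‖k‖ ^ 2 = D * ‖k‖ ^ 2 + m * (1 + ε) * ‖k‖ ^ 2 := by rw [hDdef]; ring
  linarith

end Modifier

/-! ### Entropy inequality -/

/-- Young's inequality for `x log x` and `exp`; it is `t + 1 ≤ exp t` at `t = y - log x`. -/
theorem mul_le_klFun_add_exp {x : ℝ} (hx : 0 ≤ x) (y : ℝ) :
    x * y ≤ InformationTheory.klFun x + Real.exp y - 1 := by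
  rw [InformationTheory.klFun]
  rcases hx.eq_or_lt with rfl | hx
  · simp [Real.exp_nonneg]
  · have h1 := Real.add_one_le_exp (y - Real.log x)
    rw [Real.exp_sub, Real.exp_log hx, le_div_iff₀ hx] at h1
    linarith

/-- A linearised form of the Donsker–Varadhan variational inequality. -/
theorem integral_le_toReal_klDiv_add {α : Type*} [MeasurableSpace α] (κ π : Measure α)
    [IsProbabilityMeasure κ] [IsProbabilityMeasure π] (hR : InformationTheory.klDiv κ π ≠ ∞)
    {F : α → ℝ} (hF : Measurable F) {c : ℝ} (hc : ∀ x, |F x| ≤ c) (a : ℝ) :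
    ∫ x, F x ∂κ ≤ (InformationTheory.klDiv κ π).toReal + a - 1 +
      Real.exp (-a) * ∫ x, Real.exp (F x) ∂π := by
  obtain ⟨hac, hint⟩ := InformationTheory.klDiv_ne_top_iff.1 hR
  have hexp : Integrable (fun x => Real.exp (F x)) π := by
    refine Integrable.of_bound hF.exp.aestronglyMeasurable (Real.exp c)
      (Eventually.of_forall fun x => ?_)
    rw [Real.norm_eq_abs, Real.abs_exp]
    exact Real.exp_le_exp.2 ((le_abs_self _).trans (hc x))
  have hFi : Integrable (fun x => F x - a) κ :=
    (Integrable.of_bound hF.aestronglyMeasurable c (Eventually.of_forall hc)).sub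
      (integrable_const a)
  have hkl : Integrable (fun x => InformationTheory.klFun (κ.rnDeriv π x).toReal) π :=
    (InformationTheory.integrable_klFun_rnDeriv_iff hac).2 hint
  have h1 : ∫ x, (F x - a) ∂κ = ∫ x, (κ.rnDeriv π x).toReal * (F x - a) ∂π :=
    (integral_toReal_rnDeriv_mul hac).symm
  -- Young's inequality for the density, tested against `F - a`. The shift `a` replaces `log z` by
  -- its affine majorant `a - 1 + exp (-a) z`, which keeps the bound linear in the exponential
  -- moment.
  have h2 : ∫ x, (κ.rnDeriv π x).toReal * (F x - a) ∂π ≤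
      ∫ x, (InformationTheory.klFun (κ.rnDeriv π x).toReal +
        Real.exp (-a) * Real.exp (F x) - 1) ∂π := by
    refine integral_mono ((integrable_toReal_rnDeriv_mul_iff hac).2 hFi)
      ((hkl.add (hexp.const_mul (Real.exp (-a)))).sub (integrable_const 1)) fun x => ?_
    refine (mul_le_klFun_add_exp ENNReal.toReal_nonneg _).trans (le_of_eq ?_)
    rw [sub_eq_neg_add (F x) a, Real.exp_add]
  have hsum : Integrable (fun x => InformationTheory.klFun (κ.rnDeriv π x).toReal +
      Real.exp (-a) * Real.exp (F x)) π := hkl.add (hexp.const_mul _)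
  rw [integral_sub hsum (integrable_const 1), integral_add hkl (hexp.const_mul _), integral_const_mul,
    ← InformationTheory.toReal_klDiv_eq_integral_klFun hac] at h2
  rw [integral_sub (Integrable.of_bound hF.aestronglyMeasurable c (Eventually.of_forall hc))
    (integrable_const a)] at h1
  simp only [integral_const, probReal_univ, one_smul] at h1 h2
  linarith

/-! ### Stratified sampling of the exponential functional -/

/-- Separates the crude bound `m` used to build the operator from the essential bound `m'`; the
latter enters the final constants. -/
theorem norm_mulOp_le {E : Type*} [MeasurableSpace E] {μ : Measure E} {V : E → ℝ}
    (hV : Measurable V) {m : ℝ} (hm : ∀ᵐ x ∂μ, |V x| ≤ m) {m' : ℝ} (hm' : ∀ᵐ x ∂μ, |V x| ≤ m')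
    (g : Lp ℝ 2 μ) : ‖mulOp V hV m hm g‖ ≤ m' * ‖g‖ := by
  refine Lp.norm_le_mul_norm_of_ae_le_mul ?_
  filter_upwards [mulOp_apply V hV m hm g, hm'] with x hx hmx
  rw [hx, norm_mul]
  exact mul_le_mul_of_nonneg_right hmx (norm_nonneg _)

/-- Multiplication by a bounded function. -/
abbrev potential {E : Type*} [MeasurableSpace E] {V : E → ℝ} {m : ℝ} (μ : Measure E) (hV : Measurable V)
    (hm : ∀ x, |V x| ≤ m) : Lp ℝ 2 μ →L[ℝ] Lp ℝ 2 μ :=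
  mulOp V hV m (Eventually.of_forall hm)

namespace MarkovProcess

variable {E Ω : Type*} [MeasurableSpace E] [mΩ : MeasurableSpace Ω] {M : MarkovProcess E Ω}
  {μ : Measure E} [IsProbabilityMeasure μ]

/-- The functional `g ↦ E[Z g(X_s)]` on `L²(μ)`. -/
def evalFunctional (h : M.Invariant μ) (s : ℝ≥0) (z : Lp ℝ 2 (M.lawFrom μ)) :
    Lp ℝ 2 μ →L[ℝ] ℝ :=
  (innerSL ℝ z).comp (pull h s).toContinuousLinearMap

theorem evalFunctional_toLp (h : M.Invariant μ) (s : ℝ≥0) {Z : Ω → ℝ}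
    (hZ : MemLp Z 2 (M.lawFrom μ)) (g : Lp ℝ 2 μ) :
    evalFunctional h s (hZ.toLp Z) g = ∫ ω, Z ω * g (M.X s ω) ∂(M.lawFrom μ) := by
  change ⟪hZ.toLp Z, pull h s g⟫ = _
  rw [L2.inner_def]
  refine integral_congr_ae ?_
  filter_upwards [hZ.coeFn_toLp, pull_apply h s g] with ω h1 h2
  rw [h1, h2, RCLike.inner_apply, conj_trivial, mul_comm]

variable {V : E → ℝ} (hV : Measurable V) {m : ℝ} (hm : ∀ x, |V x| ≤ m)

theorem weight_bounds {V : E → ℝ} {m : ℝ} (hm : ∀ x, |V x| ≤ m) {h : ℝ} (hh : 0 ≤ h)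
    (hhm : h * m ≤ 1 / 2) (x : E) : |h * V x| ≤ 1 / 2 := by
  rw [abs_mul, abs_of_nonneg hh]
  exact (mul_le_mul_of_nonneg_left (hm x) hh).trans hhm

/-- The Markov property twice: at time `s + r`, with the weighted past, and then at time `s`. -/
theorem integral_mul_weight (hinv : M.Invariant μ) {h : ℝ} (hh : 0 ≤ h)
    (hhm : h * m ≤ 1 / 2) (s r t : ℝ≥0) {Z : Ω → ℝ} (hZ : Measurable[M.filtration s] Z)
    (hZ0 : ∀ ω, 0 ≤ Z ω) {c : ℝ} (hZc : ∀ ω, Z ω ≤ c) (g : Lp ℝ 2 μ) :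
    ∫ ω, Z ω * (1 + h * V (M.X (s + r) ω)) * g (M.X (s + r + t) ω) ∂(M.lawFrom μ) =
      ∫ ω, Z ω * semigroup hinv r (semigroup hinv t g +
        h • potential μ hV hm (semigroup hinv t g)) (M.X s ω) ∂(M.lawFrom μ) := by
  have hb := weight_bounds hm hh hhm
  have hW : Measurable[M.filtration (s + r)] fun ω => Z ω * (1 + h * V (M.X (s + r) ω)) := by
    have h1 : Measurable[M.filtration (s + r)] Z :=
      hZ.mono (M.filtration.mono (le_add_of_nonneg_right r.2)) le_rfl
    have h2 : Measurable[M.filtration (s + r)] fun ω => V (M.X (s + r) ω) :=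
      hV.comp (M.adapted (s + r))
    exact h1.mul ((h2.const_mul h).const_add 1)
  have hW0 : ∀ x, 0 ≤ 1 + h * V x := fun x => by linarith [(abs_le.1 (hb x)).1]
  have hc0 : ∀ ω, Z ω * (1 + h * V (M.X (s + r) ω)) ≤ c * (3 / 2) := fun ω =>
    mul_le_mul (hZc ω) (by linarith [(abs_le.1 (hb (M.X (s + r) ω))).2]) (hW0 _)
      ((hZ0 ω).trans (hZc ω))
  rw [integral_mul_semigroup hinv (s + r) t hW (fun ω => mul_nonneg (hZ0 ω) (hW0 _)) hc0 g,
    ← integral_mul_semigroup hinv s r hZ hZ0 hZc]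
  refine integral_congr_ae ?_
  set gt := semigroup hinv t g
  have hae : ∀ᵐ x ∂μ, (gt + h • potential μ hV hm gt : Lp ℝ 2 μ) x = (1 + h * V x) * gt x := by
    filter_upwards [Lp.coeFn_add gt (h • potential μ hV hm gt),
      Lp.coeFn_smul h (potential μ hV hm gt),
      mulOp_apply V hV m (Eventually.of_forall hm) gt] with x h1 h2 h3
    rw [h1, Pi.add_apply, h2, Pi.smul_apply, h3, smul_eq_mul]
    ring
  filter_upwards [(hinv.measurePreserving (s + r)).quasiMeasurePreserving.ae hae] with ω hω
  rw [hω]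
  ring

/-- Averaged over `r` in `(0, h]`, the left side equals the right side by `dyson_eq_integral`; some
`r` does not exceed the average. The same `r` must serve the baseline weight and the alternative's
mean `F`, so their difference is averaged. -/
theorem exists_sample_time (hinv : M.Invariant μ) (hcont : StronglyContinuous hinv) {h : ℝ≥0}
    (hh : 0 < h) (hhm : h * m ≤ 1 / 2) (s : ℝ≥0) {Z : Ω → ℝ}
    (hZ : Measurable[M.filtration s] Z) (hZ0 : ∀ ω, 0 ≤ Z ω) {c : ℝ} (hZc : ∀ ω, Z ω ≤ c)
    (g : Lp ℝ 2 μ) (C : ℝ) {F : ℝ → ℝ} (hF : ∀ a b, IntervalIntegrable F volume a b) :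
    ∃ r : ℝ≥0, r ≤ h ∧
      C * ∫ ω, Z ω * (1 + h * V (M.X (s + r) ω)) * g (M.X (s + h) ω) ∂(M.lawFrom μ) -
        h * F (s + r) ≤
      C * ∫ ω, Z ω * (isContractionSemigroup hinv hcont).dyson (potential μ hV hm) h g (M.X s ω)
        ∂(M.lawFrom μ) - ∫ r in (s : ℝ)..(s + h), F r := by
  set hU := isContractionSemigroup hinv hcont
  set Vo := potential μ hV hm
  have hh' : (0 : ℝ) < h := hh
  have hZL : MemLp Z 2 (M.lawFrom μ) := by
    refine MemLp.of_bound (hZ.mono (M.filtration.le s) le_rfl).aestronglyMeasurable c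
      (Eventually.of_forall fun ω => ?_)
    rw [Real.norm_eq_abs, abs_of_nonneg (hZ0 ω)]
    exact hZc ω
  set ℓ := evalFunctional hinv s (hZL.toLp Z)
  set w : ℝ → Lp ℝ 2 μ := fun r => hU.flow r (hU.flow (h - r) g + (h : ℝ) • Vo (hU.flow (h - r) g))
  have hwc : Continuous w := by
    have h1 : Continuous fun r : ℝ => hU.flow (h - r) g :=
      hU.continuous_flow_comp (continuous_const.sub continuous_id) continuous_const
    exact hU.continuous_flow_comp continuous_id
      (h1.add ((Vo.continuous.comp h1).const_smul (h : ℝ)))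
  have hFs : IntervalIntegrable (fun r => F (s + r)) volume 0 h := by
    have := (hF s (s + h)).comp_add_left (c := (s : ℝ))
    simpa using this
  have hℓw : IntervalIntegrable (fun r => C * ℓ (w r)) volume 0 h :=
    ((ℓ.continuous.comp hwc).const_mul C).intervalIntegrable _ _
  have hΦ : IntervalIntegrable (fun r => C * ℓ (w r) - h * F (s + r)) volume 0 h :=
    hℓw.sub (hFs.const_mul _)
  have hint : ∫ r in (0 : ℝ)..h, (C * ℓ (w r) - h * F (s + r)) =
      h * (C * ℓ (hU.dyson Vo h g) - ∫ r in (s : ℝ)..(s + h), F r) := by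
    rw [intervalIntegral.integral_sub hℓw (hFs.const_mul _), intervalIntegral.integral_const_mul,
      intervalIntegral.integral_const_mul,
      ContinuousLinearMap.intervalIntegral_comp_comm _ (hwc.intervalIntegrable _ _),
      ← hU.dyson_eq_integral Vo hh' g, map_smul, smul_eq_mul,
      intervalIntegral.integral_comp_add_left, add_zero]
    ring
  obtain ⟨r, hr, hle⟩ := exists_le_setAverage (μ := volume) (s := Set.Ioc (0 : ℝ) h)
    (f := fun r => C * ℓ (w r) - h * F (s + r)) (by simpa using hh'.ne') (by simp)
    ((intervalIntegrable_iff_integrableOn_Ioc_of_le hh'.le).1 hΦ)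
  rw [setAverage_eq, ← intervalIntegral.integral_of_le hh'.le, hint, Real.volume_real_Ioc,
    sub_zero, max_eq_left hh'.le, smul_eq_mul, inv_mul_cancel_left₀ hh'.ne'] at hle
  obtain ⟨hr0, hrh⟩ := hr
  lift r to ℝ≥0 using hr0.le
  have hrh' : r ≤ h := NNReal.coe_le_coe.1 hrh
  refine ⟨r, hrh', ?_⟩
  have e1 : ∫ ω, Z ω * (1 + h * V (M.X (s + r) ω)) * g (M.X (s + h) ω)
      ∂(M.lawFrom μ) = ℓ (w r) := by
    have hsum : s + h = s + r + (h - r) := by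
      rw [add_assoc, add_tsub_cancel_of_le hrh']
    rw [hsum, integral_mul_weight hV hm hinv h.coe_nonneg hhm s _ _ hZ hZ0 hZc g,
      evalFunctional_toLp]
    simp only [w, IsContractionSemigroup.flow_apply, Real.toNNReal_coe, ← NNReal.sub_def]
    rfl
  rw [e1, ← evalFunctional_toLp hinv s hZL]
  exact hle

/-- Interpolates between `∫ Kⁿ 1 dμ` at `k = 0` and the fully sampled weight at `k = n`, replacing
Dyson operators by sampled factors one window at a time. -/
theorem exists_sample_times (hinv : M.Invariant μ) (hcont : StronglyContinuous hinv) {h : ℝ≥0}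
    (hh : 0 < h) (hhm : h * m ≤ 1 / 2) (n : ℕ) (C : ℝ) {F : ℝ → ℝ}
    (hF : ∀ a b, IntervalIntegrable F volume a b) (k : ℕ) (hk : k ≤ n) :
    ∃ τ : ℕ → ℝ≥0, (∀ i < k, τ i ≤ (i + 1) * h) ∧
      C * ∫ ω, (∏ i ∈ Finset.range k, (1 + h * V (M.X (τ i) ω))) *
          ((isContractionSemigroup hinv hcont).dyson (potential μ hV hm) h)^[n - k]
            (Lp.const 2 μ 1) (M.X (k * h) ω) ∂(M.lawFrom μ) -
        h * ∑ i ∈ Finset.range k, F (τ i) ≤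
      C * ∫ x, ((isContractionSemigroup hinv hcont).dyson (potential μ hV hm) h)^[n]
            (Lp.const 2 μ 1) x ∂μ - ∫ r in (0 : ℝ)..(k * h), F r := by
  set K := (isContractionSemigroup hinv hcont).dyson (potential μ hV hm) h with hK
  have hb := weight_bounds hm h.coe_nonneg hhm
  induction k with
  | zero =>
    refine ⟨0, by simp, ?_⟩
    simp only [Finset.range_zero, Finset.prod_empty, one_mul, Finset.sum_empty, mul_zero, sub_zero,
      Nat.cast_zero, zero_mul, intervalIntegral.integral_same]
    have := integral_map (μ := M.lawFrom μ) (M.measurable_X 0).aemeasurable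
      (f := (K^[n] (Lp.const 2 μ 1) : Lp ℝ 2 μ))
      (Lp.stronglyMeasurable _).aestronglyMeasurable
    rw [(hinv.measurePreserving 0).map_eq] at this
    rw [this, Nat.sub_zero]
  | succ k ih =>
    obtain ⟨τ, hτ, hle⟩ := ih (Nat.le_of_succ_le hk)
    set Z : Ω → ℝ := fun ω => ∏ i ∈ Finset.range k, (1 + h * V (M.X (τ i) ω)) with hZdef
    have hZ : Measurable[M.filtration (k * h)] Z := by
      refine Finset.measurable_prod _ fun i hi => ?_
      have hik : i < k := Finset.mem_range.1 hi
      -- Earlier samples lie no later than the start of window `k`, so their product is a legitimate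
      -- past weight.
      have hle : τ i ≤ k * h := (hτ i hik).trans (by gcongr; exact_mod_cast hik)
      have h2 : Measurable[M.filtration (k * h)] fun ω => V (M.X (τ i) ω) :=
        hV.comp ((M.adapted (τ i)).mono (M.filtration.mono hle) le_rfl)
      exact (h2.const_mul _).const_add 1
    have hZ0 : ∀ ω, 0 ≤ Z ω := fun ω =>
      Finset.prod_nonneg fun i _ => by linarith [(abs_le.1 (hb (M.X (τ i) ω))).1]
    have hZc : ∀ ω, Z ω ≤ (3 / 2) ^ k := fun ω => by
      have := Finset.prod_le_prod (s := Finset.range k)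
        (f := fun i => 1 + (h : ℝ) * V (M.X (τ i) ω)) (g := fun _ => (3 / 2 : ℝ))
        (fun i _ => by linarith [(abs_le.1 (hb (M.X (τ i) ω))).1])
        (fun i _ => by linarith [(abs_le.1 (hb (M.X (τ i) ω))).2])
      rwa [Finset.prod_const, Finset.card_range] at this
    obtain ⟨r, hr, hstep⟩ := exists_sample_time hV hm hinv hcont hh hhm (k * h) hZ hZ0 hZc
      (K^[n - (k + 1)] (Lp.const 2 μ 1)) C hF
    have hiter : (isContractionSemigroup hinv hcont).dyson (potential μ hV hm) h
        (K^[n - (k + 1)] (Lp.const 2 μ 1)) = K^[n - k] (Lp.const 2 μ 1) := by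
      rw [← hK, ← Function.iterate_succ_apply' K]
      congr 1
      omega
    rw [hiter] at hstep
    refine ⟨Function.update τ k (k * h + r), fun i hi => ?_, ?_⟩
    · rcases Nat.lt_succ_iff_lt_or_eq.1 hi with hi | rfl
      · rw [Function.update_of_ne hi.ne]
        exact hτ i hi
      · rw [Function.update_self, add_mul, one_mul]
        gcongr
    · have hupd : ∀ i ∈ Finset.range k, Function.update τ k (k * h + r) i = τ i := fun i hi =>
        Function.update_of_ne (Finset.mem_range.1 hi).ne _ _
      have hp : ∀ ω, ∏ i ∈ Finset.range (k + 1),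
          (1 + (h : ℝ) * V (M.X (Function.update τ k (k * h + r) i) ω)) =
          Z ω * (1 + h * V (M.X (k * h + r) ω)) := fun ω => by
        rw [Finset.prod_range_succ, Function.update_self]
        congr 1
        exact Finset.prod_congr rfl fun i hi => by rw [hupd i hi]
      have hs : ∑ i ∈ Finset.range (k + 1), F (Function.update τ k (k * h + r) i) =
          (∑ i ∈ Finset.range k, F (τ i)) + F (k * h + r) := by
        rw [Finset.sum_range_succ, Function.update_self]
        push_cast
        congr 1
        exact Finset.sum_congr rfl fun i hi => by rw [hupd i hi]
      have hkh : ((k + 1 : ℕ) : ℝ≥0) * h = k * h + h := by push_cast; ring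
      have hkh' : ((k + 1 : ℕ) : ℝ) * h = k * h + h := by push_cast; ring
      simp only [hp]
      rw [hs, hkh, hkh', ← intervalIntegral.integral_add_adjacent_intervals (hF 0 (k * h)) (hF _ _)]
      push_cast at hstep
      linarith

end MarkovProcess

/-- `log (1 + x) ≥ x / (1 + x)`, and the remaining comparison is `x² (1 + 2 x) ≥ 0`. -/
theorem sub_two_mul_sq_le_log {x : ℝ} (hx : |x| ≤ 1 / 2) : x - 2 * x ^ 2 ≤ Real.log (1 + x) := by
  obtain ⟨h1, h2⟩ := abs_le.1 hx
  have h3 : 0 < 1 + x := by linarith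
  refine le_trans ?_ (Real.one_sub_inv_le_log_of_pos h3)
  have e : 1 - (1 + x)⁻¹ = x / (1 + x) := by field_simp; ring
  rw [e, le_div_iff₀ h3]
  nlinarith [mul_nonneg (sq_nonneg x) (by linarith : (0 : ℝ) ≤ 1 + 2 * x)]

theorem abs_log_one_add_le {x : ℝ} (hx : |x| ≤ 1 / 2) : |Real.log (1 + x)| ≤ 1 := by
  obtain ⟨h1, h2⟩ := abs_le.1 hx
  have h3 : 0 < 1 + x := by linarith
  rw [abs_le]
  constructor
  · have := sub_two_mul_sq_le_log hx
    nlinarith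
  · linarith [Real.log_le_sub_one_of_pos h3]

/-! ### Expectations under the alternative process and the entropy bound. -/

section Alternative

variable {E Ω' : Type*} [MeasurableSpace E] [MeasurableSpace Ω'] {X' : ℝ≥0 → Ω' → E}
  {V : E → ℝ} {m : ℝ}

theorem measurable_timed (hX' : Measurable (Function.uncurry X')) (hV : Measurable V) :
    Measurable fun z : ℝ × Ω' => V (X' z.1.toNNReal z.2) :=
  hV.comp (hX'.comp (((continuous_real_toNNReal.measurable).comp measurable_fst).prodMk
    measurable_snd))

theorem intervalIntegrable_expectation (hX' : Measurable (Function.uncurry X')) (P' : Measure Ω')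
    [IsProbabilityMeasure P'] (hV : Measurable V) (hm : ∀ x, |V x| ≤ m) (a b : ℝ) :
    IntervalIntegrable (fun s : ℝ => ∫ ω, V (X' s.toNNReal ω) ∂P') volume a b := by
  have hmeas : StronglyMeasurable fun s : ℝ => ∫ ω, V (X' s.toNNReal ω) ∂P' :=
    (measurable_timed hX' hV).stronglyMeasurable.integral_prod_right
  refine (intervalIntegrable_const (c := m)).mono_fun hmeas.aestronglyMeasurable
    (Eventually.of_forall fun s => ?_)
  have h1 := norm_integral_le_of_norm_le_const (μ := P') (C := m)
    (f := fun ω => V (X' s.toNNReal ω)) (Eventually.of_forall fun ω => hm _)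
  rw [probReal_univ, mul_one] at h1
  exact h1.trans (le_abs_self m)

theorem integral_timeAverage (hX' : Measurable (Function.uncurry X')) (P' : Measure Ω')
    [IsProbabilityMeasure P'] (hV : Measurable V) (hm : ∀ x, |V x| ≤ m) (T : ℝ≥0) :
    ∫ ω, timeAverage X' V T ω ∂P' =
      (1 / (T : ℝ)) * ∫ s in (0 : ℝ)..T, ∫ ω, V (X' s.toNNReal ω) ∂P' := by
  simp only [timeAverage]
  rw [integral_const_mul]
  congr 1
  simp only [intervalIntegral.integral_of_le T.coe_nonneg]
  refine integral_integral_swap (f := fun ω (t : ℝ) => V (X' t.toNNReal ω)) ?_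
  refine Integrable.of_bound ?_ m (Eventually.of_forall fun z => hm _)
  exact ((measurable_timed hX' hV).comp measurable_swap).aestronglyMeasurable

-- The entropy inequality for the sampled log-weight, whose exponential under the baseline is the
-- product of `exists_sample_times`. Replacing `log (1 + h V)` by `h V` loses `2 (h m)²` per window,
-- in total `2 h T m²`.
open MarkovProcess in
theorem integral_expectation_le {Ω : Type*} [MeasurableSpace Ω] {M : MarkovProcess E Ω}
    {μ : Measure E} [IsProbabilityMeasure μ] (hinv : M.Invariant μ)
    (hcont : StronglyContinuous hinv) (hX' : Measurable (Function.uncurry X')) (P' : Measure Ω')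
    [IsProbabilityMeasure P'] (hV : Measurable V) (hm : ∀ x, |V x| ≤ m) {T : ℝ≥0}
    (hR : InformationTheory.klDiv (pathLaw X' P' T) (pathLaw M.X (M.lawFrom μ) T) ≠ ∞)
    {h : ℝ≥0} (hh : 0 < h) (hhm : h * m ≤ 1 / 2) {n : ℕ} (hn : n * h = T) (a : ℝ) :
    ∫ s in (0 : ℝ)..T, ∫ ω, V (X' s.toNNReal ω) ∂P' ≤
      (InformationTheory.klDiv (pathLaw X' P' T) (pathLaw M.X (M.lawFrom μ) T)).toReal + a - 1 +
        Real.exp (-a) * (∫ x, ((isContractionSemigroup hinv hcont).dyson (potential μ hV hm) h)^[n]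
            (Lp.const 2 μ 1) x ∂μ) + 2 * h * T * m ^ 2 := by
  set F : ℝ → ℝ := fun s => ∫ ω, V (X' s.toNNReal ω) ∂P' with hFdef
  obtain ⟨τ, hτ, hle⟩ := exists_sample_times hV hm hinv hcont hh hhm n (Real.exp (-a))
    (intervalIntegrable_expectation hX' P' hV hm) n le_rfl
  have hnh : (n : ℝ) * h = T := by exact_mod_cast hn
  have hb := weight_bounds hm h.coe_nonneg hhm
  have hτT : ∀ i < n, τ i ≤ T := fun i hi => (hτ i hi).trans (by
    rw [← hn]
    gcongr
    exact_mod_cast hi)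
  have hX't : ∀ t, Measurable (X' t) := fun t => hX'.comp measurable_prodMk_left
  have hpath' : Measurable fun ω (t : Set.Icc (0 : ℝ≥0) T) => X' t ω :=
    measurable_pi_lambda _ fun t => hX't t
  have hpath : Measurable fun ω (t : Set.Icc (0 : ℝ≥0) T) => M.X t ω :=
    measurable_pi_lambda _ fun t => M.measurable_X t
  have hp1 : IsProbabilityMeasure (pathLaw X' P' T) :=
    Measure.isProbabilityMeasure_map hpath'.aemeasurable
  have hp2 : IsProbabilityMeasure (pathLaw M.X (M.lawFrom μ) T) :=
    Measure.isProbabilityMeasure_map hpath.aemeasurable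
  -- The truncation only supplies a default outside `i < n`. The functional `G` reads finitely many
  -- coordinates, hence is measurable on path space.
  let σ : ℕ → Set.Icc (0 : ℝ≥0) T := fun i => ⟨min (τ i) T, zero_le, min_le_right _ _⟩
  have hσ : ∀ i ∈ Finset.range n, (σ i : ℝ≥0) = τ i := fun i hi =>
    min_eq_left (hτT i (Finset.mem_range.1 hi))
  let G : (Set.Icc (0 : ℝ≥0) T → E) → ℝ := fun x =>
    ∑ i ∈ Finset.range n, Real.log (1 + h * V (x (σ i)))
  have hG : Measurable G := Finset.measurable_sum _ fun i _ =>
    ((hV.comp (measurable_pi_apply (σ i))).const_mul (h : ℝ)).const_add 1 |>.log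
  have hGb : ∀ x, |G x| ≤ n := fun x => by
    refine (Finset.abs_sum_le_sum_abs _ _).trans ?_
    refine (Finset.sum_le_sum fun i _ => abs_log_one_add_le (hb (x (σ i)))).trans ?_
    simp
  have hdv := integral_le_toReal_klDiv_add _ _ hR hG hGb a
  have hexp : ∫ x, Real.exp (G x) ∂(pathLaw M.X (M.lawFrom μ) T) =
      ∫ ω, ∏ i ∈ Finset.range n, (1 + h * V (M.X (τ i) ω)) ∂(M.lawFrom μ) := by
    rw [pathLaw, integral_map hpath.aemeasurable hG.exp.aestronglyMeasurable]
    refine integral_congr_ae (Eventually.of_forall fun ω => ?_)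
    simp only [G]
    rw [Real.exp_sum]
    refine Finset.prod_congr rfl fun i hi => ?_
    rw [Real.exp_log (by linarith [(abs_le.1 (hb (M.X (σ i) ω))).1]), hσ i hi]
  have hlow : ∑ i ∈ Finset.range n, (h * F (τ i) - 2 * (h * m) ^ 2) ≤
      ∫ x, G x ∂(pathLaw X' P' T) := by
    rw [pathLaw, integral_map hpath'.aemeasurable hG.aestronglyMeasurable]
    simp only [G]
    have hint : ∀ i, Integrable (fun ω => Real.log (1 + h * V (X' (σ i) ω))) P' := fun i =>
      Integrable.of_bound (((hV.comp (hX't _)).const_mul (h : ℝ)).const_add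
        1).log.aestronglyMeasurable 1 (Eventually.of_forall fun ω => abs_log_one_add_le (hb _))
    rw [integral_finsetSum _ fun i _ => hint i]
    refine Finset.sum_le_sum fun i hi => ?_
    have hVi : Integrable (fun ω => V (X' (τ i) ω)) P' :=
      Integrable.of_bound (hV.comp (hX't _)).aestronglyMeasurable m
        (Eventually.of_forall fun ω => hm _)
    have e : h * F (τ i) - 2 * (h * m) ^ 2 =
        ∫ ω, (h * V (X' (τ i) ω) - 2 * (h * m) ^ 2) ∂P' := by
      rw [integral_sub (hVi.const_mul _) (integrable_const _), integral_const_mul]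
      simp [hFdef]
    rw [e]
    refine integral_mono ((hVi.const_mul _).sub (integrable_const _)) (hint i) fun ω => ?_
    rw [hσ i hi]
    refine le_trans ?_ (sub_two_mul_sq_le_log (hb _))
    have : (h * V (X' (τ i) ω)) ^ 2 ≤ (h * m) ^ 2 := by
      rw [← sq_abs, abs_mul, abs_of_nonneg h.coe_nonneg]
      gcongr
      exact hm _
    linarith
  rw [hexp] at hdv
  rw [Finset.sum_sub_distrib, ← Finset.mul_sum] at hlow
  simp only [Finset.sum_const, Finset.card_range, nsmul_eq_mul] at hlow
  rw [hnh, Nat.sub_self, hn] at hle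
  have hone : ∫ ω, (∏ i ∈ Finset.range n, (1 + h * V (M.X (τ i) ω))) *
      (Lp.const 2 μ (1 : ℝ)) (M.X T ω) ∂(M.lawFrom μ) =
      ∫ ω, ∏ i ∈ Finset.range n, (1 + h * V (M.X (τ i) ω)) ∂(M.lawFrom μ) := by
    refine integral_congr_ae ?_
    filter_upwards [(hinv.measurePreserving T).quasiMeasurePreserving.ae
      (Lp.coeFn_const (p := 2) (μ := μ) (1 : ℝ))] with ω hω
    rw [hω]
    simp
  simp only [Function.iterate_zero, id_eq] at hle
  rw [hone] at hle
  have hmul : (n : ℝ) * (2 * (h * m) ^ 2) = 2 * h * T * m ^ 2 := by rw [← hnh]; ring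
  rw [hmul] at hlow
  linarith

end Alternative

/-! ### The growth of the perturbed semigroup -/

section Growth

variable {E : Type*} [MeasurableSpace E] {μ : Measure E} [IsProbabilityMeasure μ]

theorem inner_const_one (g : Lp ℝ 2 μ) : ⟪Lp.const 2 μ (1 : ℝ), g⟫ = ∫ x, g x ∂μ := by
  rw [L2.inner_def]
  refine integral_congr_ae ?_
  filter_upwards [Lp.coeFn_const (p := 2) (μ := μ) (1 : ℝ)] with x hx
  rw [hx, RCLike.inner_apply]
  simp

theorem norm_const_one : ‖Lp.const 2 μ (1 : ℝ)‖ = 1 := by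
  have h : ‖Lp.const 2 μ (1 : ℝ)‖ ^ 2 = 1 := by
    rw [← real_inner_self_eq_norm_sq, inner_const_one,
      integral_congr_ae (Lp.coeFn_const (p := 2) (μ := μ) (1 : ℝ))]
    simp
  exact (pow_eq_one_iff_of_nonneg (norm_nonneg _) two_ne_zero).1 h

theorem variance_eq_norm_sq (g : Lp ℝ 2 μ) :
    Var[(g : E → ℝ); μ] =
      ‖g - ⟪Lp.const 2 μ (1 : ℝ), g⟫ • Lp.const 2 μ (1 : ℝ)‖ ^ 2 := by
  have h1 : ‖g‖ ^ 2 = ∫ x, (g x) ^ 2 ∂μ := by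
    rw [← real_inner_self_eq_norm_sq, L2.inner_def]
    refine integral_congr_ae (Eventually.of_forall fun x => ?_)
    simp only [RCLike.inner_apply, conj_trivial]
    ring
  rw [variance_eq_sub (Lp.memLp g), norm_sub_sq_real, inner_smul_right, norm_smul, norm_const_one,
    real_inner_comm (Lp.const 2 μ (1 : ℝ)) g, mul_one, Real.norm_eq_abs, sq_abs, h1,
    ← inner_const_one]
  simp only [Pi.pow_apply]
  ring

theorem kernelOp_const_one {κ : Kernel E E} [IsMarkovKernel κ] (h : κ.Invariant μ) :
    kernelOp κ h (Lp.const 2 μ (1 : ℝ)) = Lp.const 2 μ (1 : ℝ) := by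
  refine Lp.ext ?_
  have hone := Lp.coeFn_const (p := 2) (μ := μ) (1 : ℝ)
  refine (kernelOp_apply κ h _).trans ((average_congr h hone).trans ?_)
  refine EventuallyEq.trans (Eventually.of_forall fun x => ?_) hone.symm
  simp

open MarkovProcess in
theorem inner_const_one_semigroup {Ω : Type*} [MeasurableSpace Ω] {M : MarkovProcess E Ω}
    (h : M.Invariant μ) (t : ℝ≥0) (g : Lp ℝ 2 μ) :
    ⟪Lp.const 2 μ (1 : ℝ), semigroup h t g⟫ = ⟪Lp.const 2 μ (1 : ℝ), g⟫ := by
  have hp : ∀ s, pull h s (Lp.const 2 μ (1 : ℝ)) = Lp.const 2 (M.lawFrom μ) (1 : ℝ) := fun s => by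
    refine Lp.ext ((pull_apply h s _).trans ?_)
    filter_upwards [(h.measurePreserving s).quasiMeasurePreserving.ae
      (Lp.coeFn_const (p := 2) (μ := μ) (1 : ℝ)),
      Lp.coeFn_const (p := 2) (μ := M.lawFrom μ) (1 : ℝ)] with ω h1 h2
    rw [h1, h2]
    rfl
  rw [inner_semigroup, hp 0, ← hp t, LinearIsometry.inner_map_map]

variable {V : E → ℝ} {hV : Measurable V} {m : ℝ} {hm : ∀ x, |V x| ≤ m}

theorem potential_symm (x y : Lp ℝ 2 μ) :
    ⟪potential μ hV hm x, y⟫ = ⟪x, potential μ hV hm y⟫ := by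
  rw [L2.inner_def, L2.inner_def]
  refine integral_congr_ae ?_
  filter_upwards [mulOp_apply V hV m (Eventually.of_forall hm) x,
    mulOp_apply V hV m (Eventually.of_forall hm) y] with z h1 h2
  simp only [RCLike.inner_apply, conj_trivial]
  rw [h1, h2]
  ring

theorem potential_const_one :
    potential μ hV hm (Lp.const 2 μ (1 : ℝ)) =ᵐ[μ] V := by
  filter_upwards [mulOp_apply V hV m (Eventually.of_forall hm) (Lp.const 2 μ (1 : ℝ)),
    Lp.coeFn_const (p := 2) (μ := μ) (1 : ℝ)] with x h1 h2
  rw [h1, h2]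
  simp

theorem inner_potential_const_one :
    ⟪potential μ hV hm (Lp.const 2 μ (1 : ℝ)), Lp.const 2 μ (1 : ℝ)⟫ =
      ∫ x, V x ∂μ := by
  rw [real_inner_comm, inner_const_one]
  exact integral_congr_ae potential_const_one

theorem norm_potential_const_one_sq :
    ‖potential μ hV hm (Lp.const 2 μ (1 : ℝ))‖ ^ 2 = ∫ x, V x ^ 2 ∂μ := by
  rw [← real_inner_self_eq_norm_sq, L2.inner_def]
  refine integral_congr_ae ?_
  filter_upwards [potential_const_one (μ := μ) (hV := hV) (hm := hm)] with x hx
  simp only [RCLike.inner_apply, conj_trivial]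
  rw [hx]
  ring

end Growth

/-! ### Optimisation over the inverse temperature. -/

section Optimisation

/-- Optimisation of the sub-gamma bound `η / l + l v₀ / (2 (1 - l b₀))` over `l`. -/
theorem le_sqrt_add_of_forall {x η v₀ v b₀ b : ℝ} (hη : 0 < η) (hv₀ : 0 ≤ v₀) (hv : v₀ ≤ v)
    (hb₀ : 0 ≤ b₀) (hb : b₀ ≤ b)
    (h : ∀ l : ℝ, 0 < l → l * b₀ < 1 → x ≤ η / l + l * v₀ / (2 * (1 - l * b₀))) :
    x ≤ √(2 * v * η) + b * η := by
  have key : ∀ δ > 0, x ≤ √(2 * (v + δ) * η) + b * η := by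
    intro δ hδ
    -- The shift by `δ` keeps `r` positive when `v = 0`.
    set v' := v + δ with hv'
    have hv'0 : 0 < v' := by linarith
    set r := √(v' / (2 * η)) with hr
    have hr0 : 0 < r := Real.sqrt_pos.2 (by positivity)
    have hr2 : r ^ 2 = v' / (2 * η) := Real.sq_sqrt (by positivity)
    have hbr : 0 < b₀ + r := by linarith
    -- With `l = (b₀ + r)⁻¹` the bound becomes `η b₀ + η r + v₀ / (2 r)`. The chosen `r` balances
    -- the last two terms, with `v'` in place of `v₀`.
    have hl := h (b₀ + r)⁻¹ (by positivity) (by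
      rw [inv_mul_lt_iff₀ hbr]
      linarith)
    have e1 : η / (b₀ + r)⁻¹ = η * b₀ + η * r := by rw [div_inv_eq_mul]; ring
    have e2 : (b₀ + r)⁻¹ * v₀ / (2 * (1 - (b₀ + r)⁻¹ * b₀)) = v₀ / (2 * r) := by
      have : 1 - (b₀ + r)⁻¹ * b₀ = (b₀ + r)⁻¹ * r := by
        field_simp
        ring
      rw [this]
      field_simp
    have e3 : v₀ / (2 * r) ≤ η * r := by
      rw [div_le_iff₀ (by positivity)]
      have : η * r * (2 * r) = v' := by
        have : η * r * (2 * r) = 2 * η * r ^ 2 := by ring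
        rw [this, hr2]
        field_simp
      linarith
    have e4 : √(2 * v' * η) = 2 * η * r := by
      rw [Real.sqrt_eq_iff_mul_self_eq (by positivity) (by positivity)]
      have : 2 * η * r * (2 * η * r) = 4 * η ^ 2 * r ^ 2 := by ring
      rw [this, hr2]
      field_simp
      ring
    rw [e1, e2] at hl
    rw [e4]
    have : b₀ * η ≤ b * η := by gcongr
    linarith
  have hlim : Tendsto (fun δ : ℝ => √(2 * (v + δ) * η) + b * η) (𝓝[>] 0)
      (𝓝 (√(2 * v * η) + b * η)) := by
    have hc : Continuous fun δ : ℝ => √(2 * (v + δ) * η) + b * η := by fun_prop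
    have := hc.tendsto 0
    rw [add_zero] at this
    exact this.mono_left nhdsWithin_le_nhds
  refine ge_of_tendsto hlim ?_
  filter_upwards [self_mem_nhdsWithin] with δ hδ
  exact key δ hδ

end Optimisation

/-! ### The bound at a fixed inverse temperature. -/

theorem iterate_growth_le {H : Type*} {K : H → H} {q : H → ℝ} (hq : ∀ x, 0 ≤ q x) {c : ℝ}
    (hK : ∀ x, q (K x) ≤ (1 + c) * q x) (n : ℕ) (x : H) :
    q (K^[n] x) ≤ Real.exp (n * c) * q x := by
  induction n with
  | zero => simp
  | succ n ih =>
    rw [Function.iterate_succ_apply']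
    calc q (K (K^[n] x)) ≤ (1 + c) * q (K^[n] x) := hK _
      _ ≤ Real.exp c * (Real.exp (n * c) * q x) := by
        gcongr
        · exact hq _
        · linarith [Real.add_one_le_exp c]
      _ = Real.exp ((n + 1 : ℕ) * c) * q x := by
        rw [← mul_assoc, ← Real.exp_add]
        congr 2
        push_cast
        ring

-- Constants are fixed by the velocity average and killed by the antisymmetric part, and the range
-- of `T Π` lies in the range of `T`, which is orthogonal to constants.
open MarkovProcess in
theorem transportOp_annihilates {Q P Ω : Type*} [MeasurableSpace Q] [MeasurableSpace P]
    [MeasurableSpace Ω] {ν : Measure Q} [IsProbabilityMeasure ν] {ρ : Measure P}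
    [IsProbabilityMeasure ρ] {M : MarkovProcess (Q × P) Ω} (hinv : M.Invariant (ν.prod ρ))
    (hcont : StronglyContinuous hinv) :
    (∃ h : Lp.const 2 (ν.prod ρ) (1 : ℝ) ∈ (transportOp hinv).domain,
      transportOp hinv ⟨_, h⟩ = 0) ∧
      ∀ x : (transportOp hinv).domain, ⟪Lp.const 2 (ν.prod ρ) (1 : ℝ), transportOp hinv x⟫ = 0 := by
  obtain ⟨⟨h1, h2⟩, h3⟩ := antisymmPart_annihilates (isContractionSemigroup hinv hcont)
    (fun t => kernelOp_const_one (hinv t)) (inner_const_one_semigroup hinv)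
  have hfix : velocityAverage ν ρ (Lp.const 2 (ν.prod ρ) (1 : ℝ)) = Lp.const 2 (ν.prod ρ) (1 : ℝ) :=
    kernelOp_const_one _
  refine ⟨⟨?_, ?_⟩, fun x => h3 _⟩
  · change velocityAverage ν ρ _ ∈ (antisymmPart (generator (semigroup hinv))).domain
    rw [hfix]
    exact h1
  · refine Eq.trans ?_ h2
    change antisymmPart (generator (semigroup hinv)) _ = _
    congr 1
    exact Subtype.ext hfix

open MarkovProcess in
/-- Exponential change of measure bound at a fixed inverse temperature `l`. -/
theorem timeAverage_sub_le {Q P Ω Ω' : Type*} [MeasurableSpace Q] [MeasurableSpace P]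
    [MeasurableSpace Ω] [MeasurableSpace Ω'] (ν : Measure Q) [IsProbabilityMeasure ν]
    (ρ : Measure P) [IsProbabilityMeasure ρ] (M : MarkovProcess (Q × P) Ω)
    (hinv : M.Invariant (ν.prod ρ)) (hcont : StronglyContinuous hinv)
    (hdense : Dense ((transportOp hinv).domain : Set (Lp ℝ 2 (ν.prod ρ))))
    (hclos : (transportOp hinv).IsClosable)
    (ε Λ : ℝ) (hε₀ : 0 < ε) (hε₁ : ε < 1) (hΛ : 0 < Λ)
    (hypo : ∀ g : (gen hinv).domain,
      Λ * Var[((g : Lp ℝ 2 (ν.prod ρ)) : Q × P → ℝ); ν.prod ρ] ≤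
        modInner ε (modifier (transportOp hinv) hdense hclos) (-(gen hinv g)) g)
    {f : Q × P → ℝ} (hf : Measurable f) {k : ℝ} (hfb : ∀ x, |f x| ≤ k)
    {X' : ℝ≥0 → Ω' → Q × P} (hX' : Measurable (Function.uncurry X'))
    (P' : Measure Ω') [IsProbabilityMeasure P'] {T : ℝ≥0} (hT : 0 < T)
    (hR : InformationTheory.klDiv (pathLaw X' P' T) (pathLaw M.X (M.lawFrom (ν.prod ρ)) T) ≠ ∞)
    {s : ℝ} (hs0 : 0 ≤ s) (hs : ∀ᵐ x ∂(ν.prod ρ), |f x - ∫ y, f y ∂(ν.prod ρ)| ≤ s)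
    {l : ℝ} (hl : 0 < l) (hls : l * ((1 + ε) * (s / Λ)) < 1) :
    ∫ ω, timeAverage X' f T ω ∂P' - ∫ x, f x ∂(ν.prod ρ) ≤
      eta ε (InformationTheory.klDiv (pathLaw X' P' T)
        (pathLaw M.X (M.lawFrom (ν.prod ρ)) T)).toReal T / l +
      l * ((1 + ε / 2) ^ 2 * (2 * Var[f; ν.prod ρ] / Λ)) /
        (2 * (1 - l * ((1 + ε) * (s / Λ)))) := by
  set μ := ν.prod ρ with hμ
  set R := (InformationTheory.klDiv (pathLaw X' P' T) (pathLaw M.X (M.lawFrom μ) T)).toReal with hRdef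
  set c := ∫ x, f x ∂μ with hc
  set B := modifier (transportOp hinv) hdense hclos with hBdef
  set e := Lp.const 2 μ (1 : ℝ) with he
  set S := modMetric ε B with hSdef
  have hfi : Integrable f μ := Integrable.of_bound hf.aestronglyMeasurable k
    (Eventually.of_forall hfb)
  let V : Q × P → ℝ := fun x => l * (f x - c)
  have hV : Measurable V := (hf.sub_const c).const_mul l
  set m := l * (k + |c|) with hmdef
  have hm : ∀ x, |V x| ≤ m := fun x => by
    rw [abs_mul, abs_of_pos hl]
    exact mul_le_mul_of_nonneg_left ((abs_sub _ _).trans (by linarith [hfb x])) hl.le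
  have hVs : ∀ᵐ x ∂μ, |V x| ≤ l * s := by
    filter_upwards [hs] with x hx
    rw [abs_mul, abs_of_pos hl]
    exact mul_le_mul_of_nonneg_left hx hl.le
  set Vo := potential μ hV hm with hVo
  set hU := isContractionSemigroup hinv hcont with hUdef
  obtain ⟨⟨hdom, hz⟩, hort⟩ := transportOp_annihilates hinv hcont
  have hB : ∀ x, ‖B x‖ ≤ ‖x‖ / 2 := norm_modifier_le hdense hclos
  have hBe : B e = 0 := modifier_apply_eq_zero hdense hclos hort
  have hBe' : ContinuousLinearMap.adjoint B e = 0 :=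
    adjoint_modifier_apply_eq_zero hdense hclos hdom hz
  have hnorm : ‖e‖ = 1 := norm_const_one
  have hVmean : ∫ x, V x ∂μ = 0 := by
    simp only [V]
    rw [integral_const_mul, integral_sub hfi (integrable_const c)]
    simp [hc]
  have hVsq : ‖Vo e‖ ^ 2 = l ^ 2 * Var[f; μ] := by
    rw [norm_potential_const_one_sq, variance_eq_integral hf.aemeasurable, ← integral_const_mul]
    simp only [V, mul_pow]
    rfl
  have hD : l * s * (1 + ε) < Λ := by
    have : l * ((1 + ε) * (s / Λ)) = l * s * (1 + ε) / Λ := by ring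
    rwa [this, div_lt_one hΛ] at hls
  have hD' : 0 < Λ - l * s * (1 + ε) := sub_pos.2 hD
  set κ := ‖Vo e‖ ^ 2 * (1 + ε / 2) ^ 2 / (Λ - l * s * (1 + ε)) with hκ
  have hκ0 : 0 ≤ κ := by positivity
  -- This is `Λ` times the variance, written as a continuous function on `L²`.
  let d : Lp ℝ 2 μ → ℝ := fun x => Λ * ‖x - ⟪e, x⟫ • e‖ ^ 2
  have hform : ∀ x, ⟪Vo x, S x⟫ - d x ≤ κ * ⟪x, S x⟫ := fun x =>
    perturbed_form_le hε₀ hε₁ hB hnorm hBe hBe' potential_symm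
      (inner_potential_const_one.trans hVmean) (by positivity)
      (fun y => norm_mulOp_le hV _ hVs y) hD x
  have hdc : ∀ x, |d x| ≤ 4 * Λ * ‖x‖ ^ 2 := fun x => by
    have h1 : ‖x - ⟪e, x⟫ • e‖ ≤ 2 * ‖x‖ := by
      refine (norm_sub_le _ _).trans ?_
      rw [norm_smul, hnorm, mul_one]
      have := norm_inner_le_norm (𝕜 := ℝ) e x
      rw [hnorm, one_mul] at this
      linarith
    have h2 : ‖x - ⟪e, x⟫ • e‖ ^ 2 ≤ (2 * ‖x‖) ^ 2 := by gcongr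
    rw [abs_of_nonneg (by positivity)]
    change Λ * _ ≤ _
    nlinarith
  have hyp : ∀ z ∈ generatorGraph (semigroup hinv), d z.1 ≤ -⟪z.2, S z.1⟫ := by
    intro z hz
    rw [← generator_graph] at hz
    obtain ⟨g, hg1, hg2⟩ := (LinearPMap.mem_graph_iff _).1 hz
    have h1 := hypo g
    rw [modInner_eq_inner, variance_eq_norm_sq, inner_neg_left] at h1
    rw [← hg1, ← hg2]
    exact h1
  have hSnn : ∀ x, (1 - ε) * ‖x‖ ^ 2 ≤ ⟪x, S x⟫ := le_inner_modMetric hε₀.le hB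
  have hε : 0 < 1 - ε := sub_pos.2 hε₁
  obtain ⟨C, hC0, hC⟩ := hU.dyson_growth (modMetric_symm ε B) (d := d) (by fun_prop) hdc hyp hε
    hSnn hκ0 hform
  have hSe : ⟪e, S e⟫ = 1 := by
    rw [hSdef, modMetric_apply, hBe, hBe', add_zero, smul_zero, add_zero,
      real_inner_self_eq_norm_sq, hnorm, one_pow]
  set r := (1 - ε) ^ (-(1 / 2) : ℝ) with hr
  have hr0 : 0 < r := Real.rpow_pos_of_pos hε _
  have hr2 : r ^ 2 * (1 - ε) = 1 := by
    rw [hr, ← Real.rpow_natCast, ← Real.rpow_mul hε.le]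
    norm_num
    rw [Real.rpow_neg_one, inv_mul_cancel₀ hε.ne']
  -- `exp a = r exp (κ T)` is the limiting bound for the exponential moment, so the linearised
  -- entropy inequality loses nothing relative to this bound as `n → ∞`.
  set a := Real.log r + κ * T with ha
  set I := ∫ t in (0 : ℝ)..T, ∫ ω, V (X' t.toNNReal ω) ∂P' with hI
  have hTpos : (0 : ℝ) < T := hT
  have hstep : ∀ n : ℕ, 0 < n → (T : ℝ) / n ≤ 1 → (T : ℝ) / n * m ≤ 1 / 2 →
      I ≤ R + a - 1 + Real.exp (C * T * (T / n) / 2) + 2 * (T / n) * T * m ^ 2 := by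
    intro n hn hT1 hTm
    have hn' : (0 : ℝ) < n := by exact_mod_cast hn
    have hh : 0 < T / n := div_pos hT (by exact_mod_cast hn)
    have hcoe : ((T / n : ℝ≥0) : ℝ) = T / n := by simp
    have hnh : (n : ℝ≥0) * (T / n) = T := mul_div_cancel₀ _ (by exact_mod_cast hn.ne')
    have h1 := integral_expectation_le hinv hcont hX' P' hV hm hR hh
      (by rw [hcoe]; exact hTm) hnh a
    rw [hcoe] at h1
    set h : ℝ := T / n with hhdef
    have hh0 : 0 < h := div_pos hTpos hn'
    have hnhr : (n : ℝ) * h = T := mul_div_cancel₀ _ hn'.ne'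
    set y := (hU.dyson Vo h)^[n] e with hy
    have hgr := iterate_growth_le (K := hU.dyson Vo h)
      (q := fun x => ⟪x, S x⟫) (fun x => le_trans (by positivity) (hSnn x))
      (c := 2 * κ * h + C * h ^ 2)
      (fun x => by rw [← add_assoc]; exact hC h hh0.le hT1 x) n e
    simp only [hSe, mul_one] at hgr
    have hexp : (n : ℝ) * (2 * κ * h + C * h ^ 2) = 2 * (κ * T + C * T * h / 2) := by
      rw [← hnhr]; ring
    -- Passing from the modified norm to the `L²` norm produces `r = (1 - ε)^(-1/2)`, the source of
    -- the logarithm in `eta`.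
    have hyn : ‖y‖ ≤ r * Real.exp (κ * T + C * T * h / 2) := by
      refine abs_le_of_sq_le_sq' ?_ (by positivity) |>.2
      rw [mul_pow, ← Real.exp_nat_mul, Nat.cast_ofNat, ← hexp]
      have h3 := (hSnn y).trans hgr
      calc ‖y‖ ^ 2 = r ^ 2 * ((1 - ε) * ‖y‖ ^ 2) := by rw [← mul_assoc, hr2, one_mul]
        _ ≤ _ := by gcongr
    have hint : ∫ x, y x ∂μ ≤ r * Real.exp (κ * T + C * T * h / 2) := by
      rw [← inner_const_one]
      refine (real_inner_le_norm _ _).trans ?_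
      rw [norm_const_one, one_mul]
      exact hyn
    have hexpa : Real.exp (-a) * (r * Real.exp (κ * T + C * T * h / 2)) =
        Real.exp (C * T * h / 2) := by
      rw [ha, neg_add, Real.exp_add, Real.exp_neg, Real.exp_log hr0, Real.exp_add, Real.exp_neg]
      have := Real.exp_pos (κ * T)
      field_simp
    have h4 : Real.exp (-a) * ∫ x, y x ∂μ ≤ Real.exp (C * T * h / 2) := by
      rw [← hexpa]
      gcongr
    linarith
  have hI_le : I ≤ R + a := by
    have hlim0 : Tendsto (fun n : ℕ => (T : ℝ) / n) atTop (𝓝 0) :=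
      tendsto_const_div_atTop_nhds_zero_nat _
    have hcf : Continuous fun h : ℝ =>
        R + a - 1 + Real.exp (C * T * h / 2) + 2 * h * T * m ^ 2 := by fun_prop
    have hlim := (hcf.tendsto 0).comp hlim0
    have e0 : R + a - 1 + Real.exp (C * T * 0 / 2) + 2 * 0 * T * m ^ 2 = R + a := by simp
    rw [e0] at hlim
    have hlimm : Tendsto (fun n : ℕ => (T : ℝ) / n * m) atTop (𝓝 0) := by
      simpa using hlim0.mul_const m
    refine ge_of_tendsto hlim ?_
    filter_upwards [eventually_gt_atTop 0, hlim0.eventually_le_const one_pos,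
      hlimm.eventually_le_const (by norm_num : (0 : ℝ) < 1 / 2)] with n h1 h2 h3
    exact hstep n h1 h2 h3
  have hfint := intervalIntegrable_expectation hX' P' hf hfb
  have hVf : I = l * (T * (∫ ω, timeAverage X' f T ω ∂P' - c)) := by
    have h1 : ∀ t : ℝ, ∫ ω, V (X' t.toNNReal ω) ∂P' = l * ((∫ ω, f (X' t.toNNReal ω) ∂P') - c) := by
      intro t
      have hfi' : Integrable (fun ω => f (X' t.toNNReal ω)) P' :=
        Integrable.of_bound (hf.comp (hX'.comp measurable_prodMk_left)).aestronglyMeasurable k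
          (Eventually.of_forall fun ω => hfb _)
      simp only [V]
      rw [integral_const_mul, integral_sub hfi' (integrable_const c)]
      simp
    rw [hI, integral_timeAverage hX' P' hf hfb]
    simp only [h1]
    rw [intervalIntegral.integral_const_mul, intervalIntegral.integral_sub (hfint _ _) (by simp)]
    simp only [intervalIntegral.integral_const, sub_zero, smul_eq_mul]
    field_simp
  rw [hVf] at hI_le
  have hfinal : ∫ ω, timeAverage X' f T ω ∂P' - c ≤ (R + a) / (l * T) := by
    rw [le_div_iff₀ (by positivity)]
    linarith
  refine hfinal.trans (le_of_eq ?_)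
  have hΛs : Λ - l * s * (1 + ε) = Λ * (1 - l * ((1 + ε) * (s / Λ))) := by
    field_simp
  have hx : 0 < 1 - l * ((1 + ε) * (s / Λ)) := sub_pos.2 hls
  rw [eta, ← hr, ha, hκ, hVsq, hΛs]
  set w := 1 - l * ((1 + ε) * (s / Λ))
  field_simp
  ring

end Hypocoercive

end

/-! ### Both signs of the observable, and comparison of constants. -/

theorem theorem1p2 {Q P Ω Ω' : Type*} [MeasurableSpace Q] [MeasurableSpace P]
    [MeasurableSpace Ω] [MeasurableSpace Ω']
    -- the invariant measure `μ* = ν × ρ`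
    (ν : Measure Q) [IsProbabilityMeasure ν] (ρ : Measure P) [IsProbabilityMeasure ρ]
    -- the baseline process
    (M : Hypocoercive.MarkovProcess (Q × P) Ω)
    (hinv : M.Invariant (ν.prod ρ))
    (hcont : Hypocoercive.MarkovProcess.StronglyContinuous hinv)
    -- `T Π` is densely defined and closable, so that `B` is defined
    (hdense : Dense ((Hypocoercive.transportOp hinv).domain : Set (Lp ℝ 2 (ν.prod ρ))))
    (hclos : (Hypocoercive.transportOp hinv).IsClosable)
    -- the hypocoercive estimate
    (ε Λ : ℝ) (hε₀ : 0 < ε) (hε₁ : ε < 1) (hΛ : 0 < Λ)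
    (hypo : ∀ g : (Hypocoercive.MarkovProcess.gen hinv).domain,
      Λ * Var[((g : Lp ℝ 2 (ν.prod ρ)) : Q × P → ℝ); ν.prod ρ] ≤
        Hypocoercive.modInner ε
          (Hypocoercive.modifier (Hypocoercive.transportOp hinv) hdense hclos)
          (-(Hypocoercive.MarkovProcess.gen hinv g)) g)
    -- the observable
    (f : Q × P → ℝ) (hf : Measurable f) (hfb : ∃ K : ℝ, ∀ x, |f x| ≤ K)
    -- the alternative process
    (X' : ℝ≥0 → Ω' → Q × P) (hX' : Measurable (Function.uncurry X'))
    (P' : Measure Ω') [IsProbabilityMeasure P']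
    (T : ℝ≥0) (hT : 0 < T)
    (hR : InformationTheory.klDiv (Hypocoercive.pathLaw X' P' T)
      (Hypocoercive.pathLaw M.X (M.lawFrom (ν.prod ρ)) T) ≠ ∞) :
    |∫ ω, Hypocoercive.timeAverage X' f T ω ∂P' - ∫ x, f x ∂(ν.prod ρ)| ≤
      √(2 * Hypocoercive.vConst (ν.prod ρ) f ε Λ *
          Hypocoercive.eta ε (InformationTheory.klDiv (Hypocoercive.pathLaw X' P' T)
            (Hypocoercive.pathLaw M.X (M.lawFrom (ν.prod ρ)) T)).toReal T) +
        Hypocoercive.bConst (ν.prod ρ) f ε Λ *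
          Hypocoercive.eta ε (InformationTheory.klDiv (Hypocoercive.pathLaw X' P' T)
            (Hypocoercive.pathLaw M.X (M.lawFrom (ν.prod ρ)) T)).toReal T := by
  set μ := ν.prod ρ with hμ
  set R := (InformationTheory.klDiv (Hypocoercive.pathLaw X' P' T)
    (Hypocoercive.pathLaw M.X (M.lawFrom μ) T)).toReal with hRdef
  obtain ⟨k, hk⟩ := hfb
  set s := (eLpNorm (fun x => f x - ∫ y, f y ∂μ) ∞ μ).toReal with hs
  have hs0 : 0 ≤ s := ENNReal.toReal_nonneg
  have hmem : MemLp (fun x => f x - ∫ y, f y ∂μ) ∞ μ :=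
    memLp_top_of_bound (hf.sub_const _).aestronglyMeasurable (k + |∫ y, f y ∂μ|)
      (Eventually.of_forall fun x => (norm_sub_le _ _).trans (by
        rw [Real.norm_eq_abs, Real.norm_eq_abs]
        linarith [hk x]))
  have hae : ∀ᵐ x ∂μ, |f x - ∫ y, f y ∂μ| ≤ s := by
    filter_upwards [ae_le_eLpNormEssSup (f := fun x => f x - ∫ y, f y ∂μ) (μ := μ)] with x hx
    rw [← Real.norm_eq_abs, ← toReal_enorm]
    refine ENNReal.toReal_mono hmem.2.ne ?_
    rwa [eLpNorm_exponent_top]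
  have hae' : ∀ᵐ x ∂μ, |-f x - ∫ y, -f y ∂μ| ≤ s := by
    filter_upwards [hae] with x hx
    rwa [integral_neg, sub_neg_eq_add, neg_add_eq_sub, abs_sub_comm]
  have hε : 0 < 1 - ε := sub_pos.2 hε₁
  have hR0 : 0 ≤ R := ENNReal.toReal_nonneg
  -- Strict even when the relative entropy is zero, because `ε > 0` makes the logarithm positive.
  have hη : 0 < Hypocoercive.eta ε R T := by
    have h1 : 0 < Real.log ((1 - ε) ^ (-(1 / 2) : ℝ)) :=
      Real.log_pos (Real.one_lt_rpow_of_pos_of_lt_one_of_neg hε (by linarith) (by norm_num))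
    have hT' : (0 : ℝ) < T := hT
    unfold Hypocoercive.eta
    positivity
  have hvar : 0 ≤ Var[f; μ] := variance_nonneg _ _
  -- The argument yields smaller constants than `vConst` and `bConst`. After cancelling `1 + ε / 2`,
  -- this comparison is `(1 + ε / 2) (1 - ε) ≤ (1 + ε) (1 - ε / 2)`.
  have hv : (1 + ε / 2) ^ 2 * (2 * Var[f; μ] / Λ) ≤ Hypocoercive.vConst μ f ε Λ := by
    unfold Hypocoercive.vConst
    gcongr
    rw [le_div_iff₀ hε]
    nlinarith [mul_pos hε₀ (by linarith : (0 : ℝ) < 1 + ε / 2)]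
  have hb : (1 + ε) * (s / Λ) ≤ Hypocoercive.bConst μ f ε Λ := by
    unfold Hypocoercive.bConst
    gcongr
    rw [le_div_iff₀ hε]
    nlinarith
  have upper := Hypocoercive.le_sqrt_add_of_forall hη (by positivity) hv (by positivity) hb
    fun l hl hls => Hypocoercive.timeAverage_sub_le ν ρ M hinv hcont hdense hclos ε Λ hε₀ hε₁ hΛ
      hypo hf hk hX' P' hT hR hs0 hae hl hls
  have lower := Hypocoercive.le_sqrt_add_of_forall hη (by positivity) hv (by positivity) hb
    fun l hl hls => by
      have h1 := Hypocoercive.timeAverage_sub_le ν ρ M hinv hcont hdense hclos ε Λ hε₀ hε₁ hΛ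
        hypo hf.neg (k := k) (fun x => by simpa using hk x) hX' P' hT hR hs0 hae' hl hls
      have h2 : Var[-f; μ] = Var[f; μ] := variance_neg
      rwa [h2] at h1
  have hneg : ∫ ω, Hypocoercive.timeAverage X' (-f) T ω ∂P' =
      -∫ ω, Hypocoercive.timeAverage X' f T ω ∂P' := by
    rw [← integral_neg]
    refine integral_congr_ae (Eventually.of_forall fun ω => ?_)
    simp [Hypocoercive.timeAverage]
  have hneg' : ∫ x, (-f) x ∂μ = -∫ x, f x ∂μ := integral_neg _
  rw [hneg, hneg'] at lower
  rw [abs_le]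
  constructor <;> linarith
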